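/- Let $d,m\ge 1$ be integers. For a probability distribution $G$ of a pair $(X,Y)\in\mathbb R^d\times\{0,1\}$, let $G_X$ be the law of $X$ and $\eta_G(x)=G(Y=1\mid X=x)$ (some version of) its regression function. Fix $\alpha\ge 0$, $\beta\in(0,1]$, positive constants $C_\alpha,C_\beta,c_\mu,r_\mu$, $0<\mu_-<\mu_+$, and $\gamma_i>0$, $C_i>0$ for $i=1,\dots,m$. Let $\Pi$ be the set of tuples $(P_1,\dots,P_m,Q)$ of probability distributions on $\mathbb R^d\times\{0,1\}$ which, for suitable versions of the regression functions, satisfy: (a) for every $i$ and every $x\in\mathrm{supp}(P_{i,X})\cup\mathrm{supp}(Q_X)$, $(\eta_{P_i}(x)-\tfrac12)(\eta_Q(x)-\tfrac12)\ge 0$ and $|\eta_{P_i}(x)-\tfrac12|\ge C_i|\eta_Q(x)-\tfrac12|^{\gamma_i}$ (that is, $P_i$ has relative signal exponent $\gamma_i$ with respect to $Q$); (b) $Q_X(|\eta_Q(X)-\tfrac12|<t)\le C_\alpha t^\alpha$ for all $t>0$; (c) $|\eta_Q(x)-\eta_Q(x')|\le C_\beta\|x-x'\|^\beta$ for all $x,x'\in\mathrm{supp}(Q_X)$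 ($\|\cdot\|$ is the Euclidean norm); (d) for every $i$, $P_{i,X}$ and $Q_X$ have the same support $\Omega$, Lebesgue measure $\lambda$ satisfies $\lambda(\Omega\cap B(x,r))\ge c_\mu\lambda(B(x,r))$ for all $x\in\Omega$ and $0<r\le r_\mu$, and $P_{i,X}$ and $Q_X$ have Lebesgue densities with values strictly between $\mu_-$ and $\mu_+$ on $\Omega$. Given independent samples consisting of $n_Q\ge 0$ i.i.d. draws from $Q$ and $n_{P_i}\ge 0$ i.i.d. draws from $P_i$ ($i=1,\dots,m$), not all sample sizes being zero, put $$N=n_Q+\sum_{i=1}^m n_{P_i}^{\frac{2\beta+d}{2\gamma_i\beta+d}},\qquad w_Q=N^{-\frac{\beta}{2\beta+d}},\quad w_{P_i}=N^{-\frac{\gamma_i\beta}{2\beta+d}},\quad k_Q=\Big\lfloor n_QN^{-\frac{d}{2\beta+d}}\Big\rfloor,\quad k_{P_i}=\Big\lfloor n_{P_i}N^{-\frac{d}{2\beta+d}}\Big\rfloor .$$ Let $Y^Q_{(j)}(x)$ and $Y^{P_i}_{(j)}(x)$ be the labels of the $j$-th nearest covariates to $x$ in the respective samples (ties in distance broken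 by the order in the sample), and let $$\hat\eta_{NN}(x)=\frac{w_Q\sum_{j=1}^{k_Q}Y^Q_{(j)}(x)+\sum_{i=1}^m w_{P_i}\sum_{j=1}^{k_{P_i}}Y^{P_i}_{(j)}(x)}{w_Qk_Q+\sum_{i=1}^m w_{P_i}k_{P_i}},\qquad \hat f_{NN}(x)=\mathbf 1\{\hat\eta_{NN}(x)>\tfrac12\}$$ (with $\hat f_{NN}=0$ if all neighbour counts are zero). For $f:\mathbb R^d\to\{0,1\}$ let $\mathcal E_Q(f)=Q(f(X)\ne Y)-Q(f_Q^*(X)\ne Y)$ be its excess risk, where $f_Q^*=\mathbf 1\{\eta_Q>\tfrac12\}$ is the Bayes classifier. Then there is a constant $C>0$, which does not depend on $n_Q,n_{P_1},\dots,n_{P_m}$, such that for all such sample sizes $$\sup_{(P_1,\dots,P_m,Q)\in\Pi}\mathbb E\,\mathcal E_Q(\hat f_{NN})\le C\,N^{-\frac{\beta(1+\alpha)}{2\beta+d}} .$$ -/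

import Mathlib

open MeasureTheory

noncomputable section

/-- Covariate space: `ℝ^d` with the Euclidean norm. -/
abbrev Covariate (d : ℕ) : Type := EuclideanSpace ℝ (Fin d)

/-- A labelled observation `(X, Y)` with `Y ∈ {0, 1}`. -/
abbrev Observation (d : ℕ) : Type := Covariate d × Fin 2

/-- `η` is a version of the regression function `x ↦ P(Y = 1 | X = x)`; its values off the
support of the marginal `P_X = P.fst` play no role. -/
structure IsRegressionFunction {d : ℕ} (P : Measure (Observation d)) (η : Covariate d → ℝ) :
    Prop where
  measurable : Measurable η
  mem_Icc : ∀ x, η x ∈ Set.Icc (0 : ℝ) 1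
  measure_prod : ∀ A : Set (Covariate d), MeasurableSet A →
    P (A ×ˢ {1}) = ∫⁻ x in A, ENNReal.ofReal (η x) ∂P.fst

/-- `P` has relative signal exponent `γ` with constant `Cγ` with respect to `Q`. -/
def HasRelativeSignalExponent {d : ℕ} (γ Cγ : ℝ) (P Q : Measure (Observation d))
    (ηP ηQ : Covariate d → ℝ) : Prop :=
  ∀ x ∈ P.fst.support ∪ Q.fst.support,
    0 ≤ (ηP x - 1 / 2) * (ηQ x - 1 / 2) ∧ Cγ * |ηQ x - 1 / 2| ^ γ ≤ |ηP x - 1 / 2|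

/-- The margin assumption with parameters `α`, `Cα`. -/
def MarginCondition {d : ℕ} (α Cα : ℝ) (Q : Measure (Observation d))
    (ηQ : Covariate d → ℝ) : Prop :=
  ∀ t : ℝ, 0 < t → Q.fst.real {x | |ηQ x - 1 / 2| < t} ≤ Cα * t ^ α

/-- `(β, Cβ)`-Hölder smoothness on the set `Ω`. -/
def HolderSmoothOn {d : ℕ} (β Cβ : ℝ) (Ω : Set (Covariate d)) (g : Covariate d → ℝ) : Prop :=
  ∀ x₁ ∈ Ω, ∀ x₂ ∈ Ω, |g x₁ - g x₂| ≤ Cβ * ‖x₁ - x₂‖ ^ β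

/-- Some Lebesgue density of `ν` takes values strictly between `μlo` and `μhi` on the
support of `ν`. -/
def HasDensityBetween {d : ℕ} (μlo μhi : ℝ) (ν : Measure (Covariate d)) : Prop :=
  ν ≪ volume ∧
    ∀ᵐ x ∂(volume : Measure (Covariate d)), x ∈ ν.support →
      ENNReal.ofReal μlo < ν.rnDeriv volume x ∧ ν.rnDeriv volume x < ENNReal.ofReal μhi

/-- Common support and strong density assumption for a pair of covariate distributions. -/
structure StrongDensity {d : ℕ} (μlo μhi cμ rμ : ℝ) (νP νQ : Measure (Covariate d)) :
    Prop where
  support_eq : νP.support = νQ.support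
  regular : ∀ r : ℝ, 0 < r → r ≤ rμ → ∀ x ∈ νQ.support,
    ENNReal.ofReal cμ * volume (Metric.closedBall x r)
      ≤ volume (νQ.support ∩ Metric.closedBall x r)
  density_source : HasDensityBetween μlo μhi νP
  density_target : HasDensityBetween μlo μhi νQ

/-- The multi-source posterior drift parameter space: `(P_1, ..., P_m, Q)` are probability
distributions with regression functions `ηP i`, `ηQ`, satisfying the relative signal exponent,
margin, smoothness and strong density conditions. -/
structure InPosteriorDriftClass {d m : ℕ} (α Cα β Cβ : ℝ) (γ Cγ : Fin m → ℝ)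
    (μlo μhi cμ rμ : ℝ) (P : Fin m → Measure (Observation d)) (Q : Measure (Observation d))
    (ηP : Fin m → Covariate d → ℝ) (ηQ : Covariate d → ℝ) : Prop where
  isProb_source : ∀ i, IsProbabilityMeasure (P i)
  isProb_target : IsProbabilityMeasure Q
  regression_source : ∀ i, IsRegressionFunction (P i) (ηP i)
  regression_target : IsRegressionFunction Q ηQ
  signal : ∀ i, HasRelativeSignalExponent (γ i) (Cγ i) (P i) Q (ηP i) ηQ
  margin : MarginCondition α Cα Q ηQ
  smooth : HolderSmoothOn β Cβ Q.fst.support ηQ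
  density : ∀ i, StrongDensity μlo μhi cμ rμ (P i).fst Q.fst

/-- Misclassification error `R_Q(f) = Q(f(X) ≠ Y)`. -/
def misclassificationRisk {d : ℕ} (Q : Measure (Observation d)) (f : Covariate d → Fin 2) : ℝ :=
  Q.real {z | f z.1 ≠ z.2}

/-- The Bayes classifier associated with the regression function `η`. -/
def bayesClassifier {d : ℕ} (η : Covariate d → ℝ) (x : Covariate d) : Fin 2 :=
  if η x ≤ 1 / 2 then 0 else 1

/-- Excess risk `R_Q(f) - R_Q(f*_Q)`, where `ηQ` is the regression function of `Q`. -/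
def excessRisk {d : ℕ} (Q : Measure (Observation d)) (ηQ : Covariate d → ℝ)
    (f : Covariate d → Fin 2) : ℝ :=
  misclassificationRisk Q f - misclassificationRisk Q (bayesClassifier ηQ)

/-- Effective sample size `n_Q + ∑ i, n_{P_i} ^ ((2β + d) / (2 γ_i β + d))`. -/
def effectiveSize {m : ℕ} (d : ℕ) (β : ℝ) (γ : Fin m → ℝ) (nQ : ℕ) (nP : Fin m → ℕ) : ℝ :=
  (nQ : ℝ) + ∑ i, (nP i : ℝ) ^ ((2 * β + d) / (2 * γ i * β + d))

/-- Index of the `j`-th nearest covariate to `x` in the sample `S` (counting from `0`); ties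
in distance are broken by the smaller index. -/
def neighborIndex {d n : ℕ} (S : Fin n → Observation d) (x : Covariate d) : Equiv.Perm (Fin n) :=
  Tuple.sort fun j => dist (S j).1 x

/-- Sum of the labels of the `k` nearest neighbours of `x` in the sample `S`. -/
def neighborLabelSum {d n : ℕ} (S : Fin n → Observation d) (k : ℕ) (x : Covariate d) : ℝ :=
  ∑ j : Fin n with j.val < k, (((S (neighborIndex S x j)).2 : ℕ) : ℝ)

/-- The weighted nearest neighbour estimator with given weights and neighbour counts. -/
def weightedKNNEstimator {d m nQ : ℕ} {nP : Fin m → ℕ} (wQ : ℝ) (wP : Fin m → ℝ)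
    (kQ : ℕ) (kP : Fin m → ℕ) (SQ : Fin nQ → Observation d)
    (SP : (i : Fin m) → Fin (nP i) → Observation d) (x : Covariate d) : ℝ :=
  (wQ * neighborLabelSum SQ kQ x + ∑ i, wP i * neighborLabelSum (SP i) (kP i) x) /
    (wQ * kQ + ∑ i, wP i * kP i)

/-- The multi-sample weighted nearest neighbour classifier, with weights `N ^ (-β/(2β+d))`,
`N ^ (-γ_i β/(2β+d))` and neighbour counts `⌊n N ^ (-d/(2β+d))⌋`, where `N` is the
effective sample size. -/
def multiKNNClassifier {d m nQ : ℕ} {nP : Fin m → ℕ} (β : ℝ) (γ : Fin m → ℝ)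
    (SQ : Fin nQ → Observation d) (SP : (i : Fin m) → Fin (nP i) → Observation d)
    (x : Covariate d) : Fin 2 :=
  let N := effectiveSize d β γ nQ nP
  let wQ : ℝ := N ^ (-(β / (2 * β + d)))
  let wP : Fin m → ℝ := fun i => N ^ (-(γ i * β / (2 * β + d)))
  let kQ : ℕ := ⌊(nQ : ℝ) * N ^ (-((d : ℝ) / (2 * β + d)))⌋₊
  let kP : Fin m → ℕ := fun i => ⌊(nP i : ℝ) * N ^ (-((d : ℝ) / (2 * β + d)))⌋₊
  if 1 / 2 < weightedKNNEstimator wQ wP kQ kP SQ SP x then 1 else 0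

/-- Joint law of the independent samples: `nQ` i.i.d. draws from `Q` and, for each `i`,
`nP i` i.i.d. draws from `P i`. -/
def sampleLaw {d m : ℕ} (nQ : ℕ) (nP : Fin m → ℕ) (P : Fin m → Measure (Observation d))
    (Q : Measure (Observation d)) :
    Measure ((Fin nQ → Observation d) × ((i : Fin m) → Fin (nP i) → Observation d)) :=
  (Measure.pi fun _ : Fin nQ => Q).prod
    (Measure.pi fun i : Fin m => Measure.pi fun _ : Fin (nP i) => P i)

end

/-! By Fubini, the expected excess risk is the `Q.fst`-integral of `|2 * ηQ x - 1|` times the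
probability that the classifier errs at `x`. Put `Δ = |ηQ x - 1/2|`, `δ = N ^ (-β/(2β+d))` and `u =
Δ / δ`. It suffices that this probability be at most a constant times `u ^ (-(α+2))`
(`exists_error_probability_le`): the part of the integral at margin about `2^j δ` is then of order
`2^j δ · 2^(-j(α+2)) · (2^j δ)^α = 2^(-j) δ^(1+α)`, which is summable (`integral_mul_le_of_margin`).

For the pointwise bound, take a ball around `x` whose radius is of order `Δ ^ (1/β)`, tied to the
margin and not to the sample sizes. Smoothness keeps `ηQ` on its side of `1/2` by at least `Δ/2` on
the ball, and the relative signal exponent gives `ηP i` a bias of at least `Cγ i * (Δ/2) ^ γ i` on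
the same side. An error then needs one of two events.

(1) Some sample has fewer than its prescribed number `k` of points in the ball. Strong density makes
the expected number at least `k` times a multiple of `u ^ (d/β)`, so a Chernoff bound applies.

(2) All neighbours lie in the ball, but the weighted centred label sum has the wrong sign. Given the
covariates, the labels are independent and biased. The weights satisfy `w² k ≤ 1` in each sample, so
the `m + 1` samples have total variance proxy of order `m + 1`. Some sample supplies a share of at
least `1/(m+1)` of `N`, and its signal alone is of order `u ^ γ`, with `γ = 1` for the target.
Hoeffding's bound is then exponential in `u ^ (2γ)`.

Both bounds beat any power of `u`; for small `u` the trivial bound `1` is enough. The delicate point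
is that neighbours are chosen from the data: `lintegral_exp_neighborLabelSum_le` splits over the
sorting permutation, which depends on the covariates alone. -/

/-! ### Exponential moments and product measures -/

/-- Hoeffding's lemma for a Bernoulli variable. -/
theorem bernoulli_exp_le {p : ℝ} (hp : p ∈ Set.Icc (0 : ℝ) 1) (s : ℝ) :
    p * Real.exp (-s * (1 - 1 / 2)) + (1 - p) * Real.exp (-s * (0 - 1 / 2))
      ≤ Real.exp (-(s * (p - 1 / 2)) + s ^ 2 / 8) := by
  set μ : Measure ℝ := ENNReal.ofReal p • Measure.dirac 1 + ENNReal.ofReal (1 - p) • Measure.dirac 0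
    with hμ
  have h1p : 0 ≤ 1 - p := by linarith [hp.2]
  have hprob : IsProbabilityMeasure μ := ⟨by
    simp [hμ, ← ENNReal.ofReal_add hp.1 h1p]⟩
  have hint : ∀ f : ℝ → ℝ, Measurable f → ∫ x, f x ∂μ = p * f 1 + (1 - p) * f 0 := by
    intro f hf
    have hi : ∀ (a : ℝ) (c : ℝ), Integrable f (ENNReal.ofReal c • Measure.dirac a) := fun a c =>
      (integrable_dirac (by simp)).smul_measure ENNReal.ofReal_ne_top
    rw [hμ, integral_add_measure (hi _ _) (hi _ _), integral_smul_measure, integral_smul_measure]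
    simp [ENNReal.toReal_ofReal hp.1, ENNReal.toReal_ofReal h1p]
  have hIcc : ∀ᵐ x ∂μ, (id x : ℝ) ∈ Set.Icc (0 : ℝ) 1 := by
    rw [hμ, ae_add_measure_iff]
    constructor <;> refine Measure.ae_smul_measure ?_ _ <;> simp [ae_dirac_eq]
  -- A variable in `[0, 1]` has variance proxy `1/4`. This bound is centred at the mean `p`; the
  -- factor `exp (-(s * (p - 1/2)))` moves the centre to `1/2`.
  have h := (ProbabilityTheory.hasSubgaussianMGF_of_mem_Icc (μ := μ) (X := id)
    measurable_id.aemeasurable hIcc).mgf_le (-s)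
  rw [ProbabilityTheory.mgf, hint _ (by fun_prop), hint _ (by fun_prop)] at h
  simp only [id] at h
  calc p * Real.exp (-s * (1 - 1 / 2)) + (1 - p) * Real.exp (-s * (0 - 1 / 2))
      = Real.exp (-(s * (p - 1 / 2))) * (p * Real.exp (-s * (1 - (p * 1 + (1 - p) * 0)))
          + (1 - p) * Real.exp (-s * (0 - (p * 1 + (1 - p) * 0)))) := by
        rw [mul_add, mul_left_comm, mul_left_comm _ (1 - p), ← Real.exp_add, ← Real.exp_add]
        ring_nf
    _ ≤ Real.exp (-(s * (p - 1 / 2))) * Real.exp (s ^ 2 / 8) := by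
        refine mul_le_mul_of_nonneg_left (h.trans (Real.exp_le_exp.2 ?_)) (Real.exp_nonneg _)
        simp; nlinarith [sq_nonneg s]
    _ = _ := by rw [← Real.exp_add]

/-- The integral over a product space of a product of functions of the single coordinates. -/
theorem lintegral_pi_prod {ι : Type*} [Fintype ι] {α : ι → Type*} [∀ i, MeasurableSpace (α i)]
    (μ : ∀ i, Measure (α i)) [∀ i, IsProbabilityMeasure (μ i)] {f : ∀ i, α i → ENNReal}
    (hf : ∀ i, Measurable (f i)) :
    ∫⁻ z, ∏ i, f i (z i) ∂(Measure.pi μ) = ∏ i, ∫⁻ a, f i a ∂(μ i) := by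
  have h := ProbabilityTheory.iIndepFun_pi (μ := μ) (X := f) fun i => (hf i).aemeasurable
  rw [ProbabilityTheory.lintegral_prod_eq_prod_lintegral_of_indepFun Finset.univ _ h
    fun i => (hf i).comp (measurable_pi_apply i)]
  refine Finset.prod_congr rfl fun i _ => ?_
  exact (measurePreserving_eval μ i).lintegral_comp (hf i)

/-- The indicator of a box is a product over coordinates, so both measures agree on boxes. This lets
a product weight on a sample be absorbed into its law. -/
theorem pi_withDensity {ι : Type*} [Fintype ι] {α : ι → Type*} [∀ i, MeasurableSpace (α i)]
    (μ : ∀ i, Measure (α i)) [∀ i, IsProbabilityMeasure (μ i)] {f : ∀ i, α i → ENNReal}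
    (hf : ∀ i, Measurable (f i)) [∀ i, SigmaFinite ((μ i).withDensity (f i))] :
    Measure.pi (fun i => (μ i).withDensity (f i))
      = (Measure.pi μ).withDensity fun z => ∏ i, f i (z i) := by
  refine Measure.pi_eq fun s hs => ?_
  rw [withDensity_apply _ (MeasurableSet.univ_pi hs), ← lintegral_indicator (MeasurableSet.univ_pi hs)]
  have : (Set.univ.pi s).indicator (fun z : ∀ i, α i => ∏ i, f i (z i))
      = fun z => ∏ i, (s i).indicator (f i) (z i) := by
    classical
    ext z
    by_cases hz : z ∈ Set.univ.pi s
    · rw [Set.indicator_of_mem hz]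
      exact Finset.prod_congr rfl fun i _ => (Set.indicator_of_mem (hz i trivial) _).symm
    · rw [Set.indicator_of_notMem hz]
      simp only [Set.mem_pi, Set.mem_univ, true_imp_iff, not_forall] at hz
      obtain ⟨i, hi⟩ := hz
      exact (Finset.prod_eq_zero (Finset.mem_univ i) (Set.indicator_of_notMem hi _)).symm
  rw [this, lintegral_pi_prod μ fun i => (hf i).indicator (hs i)]
  refine Finset.prod_congr rfl fun i _ => ?_
  rw [lintegral_indicator (hs i), withDensity_apply _ (hs i)]

section

variable {d : ℕ}

/-! ### Integrating out the labels -/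

namespace IsRegressionFunction

variable {P : Measure (Observation d)} [IsProbabilityMeasure P] {η : Covariate d → ℝ}

omit [IsProbabilityMeasure P] in
theorem one_sub_nonneg (h : IsRegressionFunction P η) (x : Covariate d) : 0 ≤ 1 - η x := by
  linarith [(h.mem_Icc x).2]

theorem measure_prod_zero (h : IsRegressionFunction P η) {A : Set (Covariate d)}
    (hA : MeasurableSet A) :
    P (A ×ˢ {0}) = ∫⁻ x in A, ENNReal.ofReal (1 - η x) ∂P.fst := by
  have h1 : P (A ×ˢ {1}) + P (A ×ˢ {0}) = P.fst A := by
    rw [← measure_union _ (hA.prod (measurableSet_singleton _)), Measure.fst_apply hA]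
    · congr 1
      ext ⟨x, y⟩
      simp only [Set.mem_union, Set.mem_prod, Set.mem_singleton_iff, Set.mem_preimage]
      fin_cases y <;> simp
    · rw [Set.disjoint_left]
      rintro ⟨x, y⟩ ⟨_, hy⟩ ⟨_, hy'⟩
      simp_all
  have h2 : (∫⁻ x in A, ENNReal.ofReal (η x) ∂P.fst) + ∫⁻ x in A, ENNReal.ofReal (1 - η x) ∂P.fst
      = P.fst A := by
    rw [← lintegral_add_left h.measurable.ennreal_ofReal]
    simp_rw [← ENNReal.ofReal_add (h.mem_Icc _).1 (h.one_sub_nonneg _)]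
    simp
  rw [← h2, h.measure_prod A hA] at h1
  refine (ENNReal.add_right_inj ?_).1 h1
  rw [← h.measure_prod A hA]
  exact measure_ne_top _ _

/-- Disintegration of the law of an observation along its regression function. -/
theorem eq_add_map (h : IsRegressionFunction P η) :
    P = (P.fst.withDensity fun x => ENNReal.ofReal (η x)).map (fun x => (x, (1 : Fin 2)))
      + (P.fst.withDensity fun x => ENNReal.ofReal (1 - η x)).map (fun x => (x, (0 : Fin 2))) := by
  ext S hS
  have hS1 : MeasurableSet ((fun x => (x, (1 : Fin 2))) ⁻¹' S : Set (Covariate d)) :=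
    measurable_prodMk_right hS
  have hS0 : MeasurableSet ((fun x => (x, (0 : Fin 2))) ⁻¹' S : Set (Covariate d)) :=
    measurable_prodMk_right hS
  rw [Measure.add_apply, Measure.map_apply measurable_prodMk_right hS,
    Measure.map_apply measurable_prodMk_right hS, withDensity_apply _ hS1, withDensity_apply _ hS0,
    ← h.measure_prod _ hS1, ← h.measure_prod_zero hS0,
    ← measure_union _ (hS0.prod (measurableSet_singleton _))]
  · congr 1
    ext ⟨x, y⟩
    simp only [Set.mem_union, Set.mem_prod, Set.mem_singleton_iff, Set.mem_preimage]
    fin_cases y <;> simp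
  · rw [Set.disjoint_left]
    rintro ⟨x, y⟩ ⟨_, hy⟩ ⟨_, hy'⟩
    simp_all

theorem lintegral_eq (h : IsRegressionFunction P η) {g : Observation d → ENNReal}
    (hg : Measurable g) :
    ∫⁻ z, g z ∂P
      = ∫⁻ x, (ENNReal.ofReal (η x) * g (x, 1) + ENNReal.ofReal (1 - η x) * g (x, 0)) ∂P.fst := by
  have hη := h.measurable
  conv_lhs => rw [h.eq_add_map]
  rw [lintegral_add_measure, lintegral_map hg measurable_prodMk_right,
    lintegral_map hg measurable_prodMk_right,
    lintegral_withDensity_eq_lintegral_mul _ (by fun_prop) (by fun_prop),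
    lintegral_withDensity_eq_lintegral_mul _ (by fun_prop) (by fun_prop),
    ← lintegral_add_left (by fun_prop)]
  rfl

/-- Integrating the labels out of the law of an observation with a density. -/
theorem fst_withDensity (h : IsRegressionFunction P η) {g : Observation d → ENNReal}
    (hg : Measurable g) :
    (P.withDensity g).map Prod.fst = P.fst.withDensity
      fun x => ENNReal.ofReal (η x) * g (x, 1) + ENNReal.ofReal (1 - η x) * g (x, 0) := by
  ext A hA
  rw [Measure.map_apply measurable_fst hA, withDensity_apply _ (measurable_fst hA),
    withDensity_apply _ hA, ← lintegral_indicator (measurable_fst hA),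
    h.lintegral_eq (hg.indicator (measurable_fst hA)), ← lintegral_indicator hA]
  refine lintegral_congr fun x => ?_
  by_cases hx : x ∈ A <;> simp [Set.indicator, hx]

/-- Integrating the labels out of an i.i.d. sample: conditionally on the covariates, the labels
are independent. -/
theorem lintegral_pi_mul_prod (h : IsRegressionFunction P η) {n : ℕ}
    {F : (Fin n → Covariate d) → ENNReal} (hF : Measurable F) {g : Fin n → Observation d → ENNReal}
    (hg : ∀ j, Measurable (g j)) {B : ENNReal} (hB : B ≠ ⊤) (hgB : ∀ j z, g j z ≤ B) :
    ∫⁻ S, F (fun j => (S j).1) * ∏ j, g j (S j) ∂(Measure.pi fun _ : Fin n => P)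
      = ∫⁻ X, F X * ∏ j, (ENNReal.ofReal (η (X j)) * g j (X j, 1)
          + ENNReal.ofReal (1 - η (X j)) * g j (X j, 0)) ∂(Measure.pi fun _ : Fin n => P.fst) := by
  have hη := h.measurable
  have hfin : ∀ j, IsFiniteMeasure (P.withDensity (g j)) := fun j =>
    isFiniteMeasure_withDensity (((lintegral_mono (hgB j)).trans_lt
      (by simpa using hB.lt_top)).ne)
  have hfin' : ∀ j, IsFiniteMeasure (P.fst.withDensity fun x => ENNReal.ofReal (η x) * g j (x, 1)
      + ENNReal.ofReal (1 - η x) * g j (x, 0)) := fun j => by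
    rw [← h.fst_withDensity (hg j)]; infer_instance
  have hfin'' : ∀ j, SigmaFinite ((P.withDensity (g j)).map Prod.fst) := fun j => inferInstance
  have hcomp : Measurable fun S : Fin n → Observation d => F fun j => (S j).1 :=
    hF.comp (measurable_pi_lambda _ fun j => (measurable_pi_apply j).fst)
  -- The weights `g j` tilt the law of each observation. Since `F` sees only covariates, only the
  -- covariate marginals of the tilted laws matter, and their densities are the conditional means of
  -- `g j` given the covariate.
  calc _ = ∫⁻ S, F (fun j => (S j).1) ∂(Measure.pi fun j : Fin n => P.withDensity (g j)) := by
        rw [pi_withDensity _ hg, lintegral_withDensity_eq_lintegral_mul _ (by fun_prop) hcomp]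
        simp only [Pi.mul_apply, mul_comm]
    _ = ∫⁻ X, F X ∂(Measure.pi fun j : Fin n => (P.withDensity (g j)).map Prod.fst) := by
        rw [← Measure.pi_map_pi (f := fun _ => Prod.fst) (fun _ => measurable_fst.aemeasurable),
          lintegral_map hF (by fun_prop)]
    _ = _ := by
        simp_rw [h.fst_withDensity (hg _)]
        rw [pi_withDensity _ (fun j => by fun_prop),
          lintegral_withDensity_eq_lintegral_mul _ (by fun_prop) hF]
        simp only [Pi.mul_apply, mul_comm]

end IsRegressionFunction

/-! ### Neighbour ordering and ball counts -/

/-- `Tuple.eq_sort_iff` characterises the sorting permutation by finitely many comparisons, with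
ties ordered by index. -/
theorem measurableSet_sort_eq {Ω : Type*} [MeasurableSpace Ω] {n : ℕ} {f : Ω → Fin n → ℝ}
    (hf : Measurable f) (σ : Equiv.Perm (Fin n)) : MeasurableSet {ω | Tuple.sort (f ω) = σ} := by
  have hf' : ∀ j, Measurable fun ω => f ω j := fun j => (measurable_pi_apply j).comp hf
  simp only [eq_comm (b := σ), Tuple.eq_sort_iff, Monotone, Function.comp_apply, Set.ofPred_and,
    Set.ofPred_forall]
  refine MeasurableSet.inter ?_ ?_
  · exact .iInter fun i => .iInter fun j => .iInter fun _ => measurableSet_le (hf' _) (hf' _)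
  · refine .iInter fun i => .iInter fun j => .iInter fun _ => ?_
    simp only [imp_iff_not_or, Set.ofPred_or]
    exact (measurableSet_eq_fun (hf' _) (hf' _)).compl.union (.const _)

/-- The label sum over the nearest neighbours is jointly measurable in the sample and the point. -/
theorem Measurable.neighborLabelSum {Ω : Type*} [MeasurableSpace Ω] {n : ℕ}
    {S : Ω → Fin n → Observation d} {x : Ω → Covariate d} (hS : Measurable S) (hx : Measurable x)
    (k : ℕ) : Measurable fun ω => neighborLabelSum (S ω) k (x ω) := by
  classical
  have hS' : ∀ j, Measurable fun ω => S ω j := fun j => (measurable_pi_apply j).comp hS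
  have : (fun ω => _root_.neighborLabelSum (S ω) k (x ω)) = fun ω => ∑ σ : Equiv.Perm (Fin n),
      if neighborIndex (S ω) (x ω) = σ then
        ∑ j : Fin n with j.val < k, (((S ω (σ j)).2 : ℕ) : ℝ) else 0 := by
    ext ω
    simp [_root_.neighborLabelSum]
  rw [this]
  refine Finset.measurable_fun_sum _ fun σ _ => Measurable.ite ?_ ?_ measurable_const
  · exact measurableSet_sort_eq (measurable_pi_lambda _ fun j => (hS' j).fst.dist hx) σ
  · exact Finset.measurable_fun_sum _ fun j _ =>
      (measurable_of_countable fun y : Fin 2 => ((y : ℕ) : ℝ)).comp (hS' _).snd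

theorem measurable_card_mem {α : Type*} [MeasurableSpace α] {A : Set α} (hA : MeasurableSet A)
    [DecidablePred (· ∈ A)] (n : ℕ) :
    Measurable fun S : Fin n → α => (Finset.univ.filter fun j => S j ∈ A).card := by
  simp only [Finset.card_filter]
  exact Finset.measurable_fun_sum _ fun j _ =>
    Measurable.ite (measurable_pi_apply j hA) measurable_const measurable_const

theorem measurableSet_le_card_dist_le (n k : ℕ) (x : Covariate d) (r : ℝ) :
    MeasurableSet {X : Fin n → Covariate d |
      k ≤ (Finset.univ.filter fun j => dist (X j) x ≤ r).card} := by
  classical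
  have := measurable_card_mem (A := Metric.closedBall x r) Metric.isClosed_closedBall.measurableSet n
  exact measurableSet_le measurable_const this

theorem measurableSet_le_card_dist_fst_le (n k : ℕ) (x : Covariate d) (r : ℝ) :
    MeasurableSet {S : Fin n → Observation d |
      k ≤ (Finset.univ.filter fun j => dist (S j).1 x ≤ r).card} :=
  (by fun_prop : Measurable fun (S : Fin n → Observation d) (j : Fin n) => (S j).1)
    (measurableSet_le_card_dist_le n k x r)

/-- Chernoff bound for the lower tail of the number of sample points in a set. -/
theorem measure_card_mem_lt_le {α : Type*} [MeasurableSpace α] (P : Measure α)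
    [IsProbabilityMeasure P] {A : Set α} (hA : MeasurableSet A) [DecidablePred (· ∈ A)] (n k : ℕ) :
    (Measure.pi fun _ : Fin n => P) {S | (Finset.univ.filter fun j => S j ∈ A).card < k}
      ≤ ENNReal.ofReal (Real.exp (k - n * P.real A / 2)) := by
  set g : α → ENNReal := fun z => ENNReal.ofReal (Real.exp (if z ∈ A then -1 else 0)) with hg
  have hgm : Measurable g :=
    (Measurable.ite hA measurable_const measurable_const).exp.ennreal_ofReal
  -- This yields `E g ≤ 1 - P(A)/2 ≤ exp (-P(A)/2)`, the source of the `1/2` in the exponent.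
  have hexp : Real.exp (-1) ≤ 1 / 2 := by
    rw [Real.exp_neg, one_div]
    exact inv_anti₀ (by norm_num) (by linarith [Real.add_one_le_exp (1 : ℝ)])
  have hgi : ∫⁻ z, g z ∂P ≤ ENNReal.ofReal (Real.exp (-(P.real A / 2))) := by
    rw [← lintegral_add_compl _ hA,
      setLIntegral_congr_fun (g := fun _ => ENNReal.ofReal (Real.exp (-1))) hA
        (fun z hz => by simp [hg, hz]),
      setLIntegral_congr_fun (g := fun _ => 1) hA.compl
        (fun z hz => by simp only [Set.mem_compl_iff] at hz; simp [hg, hz]),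
      setLIntegral_const, setLIntegral_const, ← ofReal_measureReal (μ := P) (s := A),
      ← ofReal_measureReal (μ := P) (s := Aᶜ), one_mul, ← ENNReal.ofReal_mul (Real.exp_nonneg _),
      ← ENNReal.ofReal_add (by positivity) (by positivity), probReal_compl_eq_one_sub hA]
    refine ENNReal.ofReal_le_ofReal ?_
    have h0 : 0 ≤ P.real A := measureReal_nonneg
    have := Real.add_one_le_exp (-(P.real A / 2))
    nlinarith
  calc _ ≤ (Measure.pi fun _ : Fin n => P)
        {S | 1 ≤ ENNReal.ofReal (Real.exp k) * ∏ j, g (S j)} := by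
        refine measure_mono fun S hS => ?_
        simp only [Set.mem_ofPred_eq] at hS ⊢
        rw [← ENNReal.ofReal_prod_of_nonneg (fun _ _ => Real.exp_nonneg _), ← Real.exp_sum,
          ← ENNReal.ofReal_mul (Real.exp_nonneg _), ← Real.exp_add, ENNReal.one_le_ofReal,
          Real.one_le_exp_iff, ← Finset.sum_filter, Finset.sum_const, nsmul_eq_mul]
        have : ((Finset.univ.filter fun j => S j ∈ A).card : ℝ) ≤ k := by exact_mod_cast hS.le
        linarith
    _ ≤ ∫⁻ S, ENNReal.ofReal (Real.exp k) * ∏ j, g (S j) ∂(Measure.pi fun _ : Fin n => P) := by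
        have := mul_meas_ge_le_lintegral (μ := Measure.pi fun _ : Fin n => P)
          (f := fun S => ENNReal.ofReal (Real.exp k) * ∏ j, g (S j)) (by fun_prop) 1
        simpa using this
    _ = ENNReal.ofReal (Real.exp k) * (∫⁻ z, g z ∂P) ^ n := by
        rw [lintegral_const_mul _ (by fun_prop), lintegral_pi_prod _ fun _ => hgm]
        simp
    _ ≤ ENNReal.ofReal (Real.exp k) * ENNReal.ofReal (Real.exp (-(P.real A / 2))) ^ n := by gcongr
    _ = _ := by
        rw [← ENNReal.ofReal_pow (Real.exp_nonneg _), ← ENNReal.ofReal_mul (Real.exp_nonneg _),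
          ← Real.exp_nat_mul, ← Real.exp_add]
        ring_nf

/-- If at least `k` sample points lie within distance `r`, so do the `k` nearest ones. -/
theorem dist_neighborIndex_le {n k : ℕ} {S : Fin n → Observation d} {x : Covariate d} {r : ℝ}
    (h : k ≤ (Finset.univ.filter fun j => dist (S j).1 x ≤ r).card) {j : Fin n} (hj : j.val < k) :
    dist (S (neighborIndex S x j)).1 x ≤ r := by
  set f : Fin n → ℝ := fun j => dist (S j).1 x
  have hcard : (Finset.univ.filter fun j => f (Tuple.sort f j) ≤ r).card
      = (Finset.univ.filter fun j => f j ≤ r).card := by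
    refine Finset.card_bij (fun j _ => Tuple.sort f j) ?_ ?_ ?_
    · simp
    · simp
    · intro b hb
      exact ⟨(Tuple.sort f).symm b, by simpa using hb, by simp⟩
  exact (Tuple.lt_card_le_iff_apply_le_of_monotone (Tuple.monotone_sort f)).1
    (hj.trans_le (h.trans_eq hcard.symm))

/-! ### Concentration of the label sum -/

/-- Exponential moments of the label sum over the nearest neighbours, on the event that these lie
within distance `r`. -/
theorem IsRegressionFunction.lintegral_exp_neighborLabelSum_le {P : Measure (Observation d)}
    [IsProbabilityMeasure P] {η : Covariate d → ℝ} (h : IsRegressionFunction P η)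
    (x : Covariate d) {r s b : ℝ} (n k : ℕ)
    (hb : ∀ y ∈ P.fst.support, dist y x ≤ r → b ≤ s * (η y - 1 / 2)) :
    ∫⁻ S in {S | k ≤ (Finset.univ.filter fun j => dist (S j).1 x ≤ r).card},
        ENNReal.ofReal (Real.exp (-(s * (neighborLabelSum S k x - k / 2))))
          ∂(Measure.pi fun _ : Fin n => P)
      ≤ ENNReal.ofReal (Real.exp (k * (-b + s ^ 2 / 8))) := by
  classical
  have hAm := measurableSet_le_card_dist_le n k x r
  have hEm := measurableSet_le_card_dist_fst_le n k x r
  -- If `n < k` the event is empty; otherwise exactly `k` labels enter the sum, matching the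
  -- centring `k / 2`.
  rcases lt_or_ge n k with hnk | hkn
  · have : {S : Fin n → Observation d |
        k ≤ (Finset.univ.filter fun j => dist (S j).1 x ≤ r).card} = ∅ := by
      ext S
      have := (Finset.card_filter_le (Finset.univ : Finset (Fin n)) fun j => dist (S j).1 x ≤ r)
      simp only [Finset.card_univ, Fintype.card_fin] at this
      simp only [Set.mem_ofPred_eq, Set.mem_empty_iff_false, iff_false, not_le]
      omega
    rw [this]
    simp
  have hcard : (Finset.univ.filter fun j : Fin n => j.val < k).card = k := by
    rw [Fin.card_filter_val_lt, min_eq_right hkn]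
  -- `A σ` is a covariate event on which the `k` nearest indices are fixed by `σ`. There the
  -- exponential is a product of one-observation factors `g σ j`, equal to `1` for indices of rank
  -- at least `k`.
  set A : Equiv.Perm (Fin n) → Set (Fin n → Covariate d) := fun σ =>
    {X | Tuple.sort (fun j => dist (X j) x) = σ} ∩
      {X | k ≤ (Finset.univ.filter fun j => dist (X j) x ≤ r).card} with hA
  have hAσ : ∀ σ, MeasurableSet (A σ) := fun σ =>
    (measurableSet_sort_eq (by fun_prop) σ).inter hAm
  set g : Equiv.Perm (Fin n) → Fin n → Observation d → ENNReal := fun σ j z =>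
    if (σ.symm j).val < k then ENNReal.ofReal (Real.exp (-s * (((z.2 : ℕ) : ℝ) - 1 / 2))) else 1
    with hg
  have hφ : Measurable fun z : Observation d =>
      ENNReal.ofReal (Real.exp (-s * (((z.2 : ℕ) : ℝ) - 1 / 2))) :=
    (measurable_of_countable fun y : Fin 2 =>
      ENNReal.ofReal (Real.exp (-s * (((y : ℕ) : ℝ) - 1 / 2)))).comp measurable_snd
  have hgm : ∀ σ j, Measurable (g σ j) := fun σ j => by
    by_cases hj : (σ.symm j).val < k
    · simpa [hg, hj] using hφ
    · simp [hg, hj]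
  have hgB : ∀ σ j z, g σ j z ≤ ENNReal.ofReal (Real.exp |s|) := fun σ j z => by
    simp only [hg]
    split_ifs
    · refine ENNReal.ofReal_le_ofReal (Real.exp_le_exp.2 ?_)
      rcases z with ⟨x, y⟩
      have := neg_abs_le s
      have := le_abs_self s
      have := abs_nonneg s
      fin_cases y <;> norm_num <;> linarith
    · rw [ENNReal.one_le_ofReal, Real.one_le_exp_iff]
      exact abs_nonneg s
  have hsum : ∀ S : Fin n → Observation d,
      ({S | k ≤ (Finset.univ.filter fun j => dist (S j).1 x ≤ r).card} : Set _).indicator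
        (fun S => ENNReal.ofReal (Real.exp (-(s * (neighborLabelSum S k x - k / 2))))) S
      = ∑ σ, (A σ).indicator 1 (fun j => (S j).1) * ∏ j, g σ j (S j) := by
    intro S
    rw [Finset.sum_eq_single (neighborIndex S x)]
    · by_cases hS : k ≤ (Finset.univ.filter fun j => dist (S j).1 x ≤ r).card
      · have hS' : (fun j => (S j).1) ∈ A (neighborIndex S x) := ⟨rfl, hS⟩
        rw [Set.indicator_of_mem hS', Set.indicator_of_mem (by exact hS), Pi.one_apply, one_mul,
          ← Equiv.prod_comp (neighborIndex S x)]
        simp only [hg, Equiv.symm_apply_apply]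
        rw [← Finset.prod_filter, ← ENNReal.ofReal_prod_of_nonneg (fun _ _ => Real.exp_nonneg _),
          ← Real.exp_sum, ← Finset.mul_sum, Finset.sum_sub_distrib, Finset.sum_const, hcard,
          nsmul_eq_mul, neighborLabelSum]
        ring_nf
      · have hS' : (fun j => (S j).1) ∉ A (neighborIndex S x) := fun h => hS h.2
        rw [Set.indicator_of_notMem hS', Set.indicator_of_notMem (by exact hS), zero_mul]
    · intro σ _ hσ
      have hS' : (fun j => (S j).1) ∉ A σ := fun h => hσ h.1.symm
      rw [Set.indicator_of_notMem hS', zero_mul]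
    · simp
  have hsupp : ∀ᵐ X ∂(Measure.pi fun _ : Fin n => P.fst), ∀ j, X j ∈ P.fst.support :=
    ae_all_iff.2 fun j =>
      (measurePreserving_eval (fun _ : Fin n => P.fst) j).quasiMeasurePreserving.ae
        Measure.support_mem_ae
  have hpt : ∀ σ X, (∀ j, X j ∈ P.fst.support) →
      (A σ).indicator (1 : (Fin n → Covariate d) → ENNReal) X * ∏ j, (ENNReal.ofReal (η (X j)) * g σ j (X j, 1)
          + ENNReal.ofReal (1 - η (X j)) * g σ j (X j, 0))
        ≤ ENNReal.ofReal (Real.exp (k * (-b + s ^ 2 / 8))) * (A σ).indicator 1 X := by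
    intro σ X hX
    by_cases hXA : X ∈ A σ
    swap
    · simp [Set.indicator_of_notMem hXA]
    rw [Set.indicator_of_mem hXA, Pi.one_apply, one_mul, mul_one, ← Equiv.prod_comp σ]
    have hle : ∀ j : Fin n, (ENNReal.ofReal (η (X (σ j))) * g σ (σ j) (X (σ j), 1)
          + ENNReal.ofReal (1 - η (X (σ j))) * g σ (σ j) (X (σ j), 0))
        ≤ if j.val < k then ENNReal.ofReal (Real.exp (-b + s ^ 2 / 8)) else 1 := by
      intro j
      have h0 := (h.mem_Icc (X (σ j))).1
      have h1 := h.one_sub_nonneg (X (σ j))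
      simp only [hg, Equiv.symm_apply_apply]
      split_ifs with hj
      · have hd : dist (X (σ j)) x ≤ r := by
          -- Neighbour order ignores labels, so a dummy label `0` is attached to the covariates.
          have := dist_neighborIndex_le (S := fun j => (X j, (0 : Fin 2))) (x := x) (r := r)
            hXA.2 hj
          have e : neighborIndex (fun j => (X j, (0 : Fin 2))) x = σ := hXA.1
          rwa [e] at this
        have hbj := hb _ (hX (σ j)) hd
        rw [← ENNReal.ofReal_mul h0, ← ENNReal.ofReal_mul h1, ← ENNReal.ofReal_add
          (mul_nonneg h0 (Real.exp_nonneg _)) (mul_nonneg h1 (Real.exp_nonneg _))]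
        refine ENNReal.ofReal_le_ofReal ?_
        have := bernoulli_exp_le (h.mem_Icc (X (σ j))) s
        simp only [Fin.val_one, Fin.val_zero, Nat.cast_one, Nat.cast_zero]
        exact this.trans (Real.exp_le_exp.2 (by linarith))
      · rw [mul_one, mul_one, ← ENNReal.ofReal_add h0 h1]
        simp
    refine (Finset.prod_le_prod' fun j _ => hle j).trans ?_
    rw [← Finset.prod_filter, Finset.prod_const, hcard, ← ENNReal.ofReal_pow (Real.exp_nonneg _),
      ← Real.exp_nat_mul]
  rw [← lintegral_indicator hEm, lintegral_congr hsum, lintegral_finsetSum']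
  swap
  · intro σ _
    have : Measurable fun S : Fin n → Observation d => (A σ).indicator (1 : (Fin n → Covariate d) → ENNReal)
        fun j => (S j).1 :=
      (measurable_one.indicator (hAσ σ)).comp (by fun_prop)
    exact (this.mul (by fun_prop)).aemeasurable
  calc _ = ∑ σ, ∫⁻ X, (A σ).indicator (1 : (Fin n → Covariate d) → ENNReal) X
          * ∏ j, (ENNReal.ofReal (η (X j)) * g σ j (X j, 1)
          + ENNReal.ofReal (1 - η (X j)) * g σ j (X j, 0)) ∂(Measure.pi fun _ : Fin n => P.fst) :=
        Finset.sum_congr rfl fun σ _ => h.lintegral_pi_mul_prod (measurable_one.indicator (hAσ σ))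
          (hgm σ) ENNReal.ofReal_ne_top (hgB σ)
    _ ≤ ∑ σ, ∫⁻ X, ENNReal.ofReal (Real.exp (k * (-b + s ^ 2 / 8))) * (A σ).indicator 1 X
          ∂(Measure.pi fun _ : Fin n => P.fst) :=
        Finset.sum_le_sum fun σ _ => lintegral_mono_ae (hsupp.mono fun X hX => hpt σ X hX)
    _ = ENNReal.ofReal (Real.exp (k * (-b + s ^ 2 / 8)))
          * ∫⁻ X, ∑ σ, (A σ).indicator 1 X ∂(Measure.pi fun _ : Fin n => P.fst) := by
        rw [lintegral_finsetSum _ fun σ _ => measurable_one.indicator (hAσ σ), Finset.mul_sum]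
        exact Finset.sum_congr rfl fun σ _ =>
          lintegral_const_mul _ (measurable_one.indicator (hAσ σ))
    _ ≤ ENNReal.ofReal (Real.exp (k * (-b + s ^ 2 / 8)))
          * ∫⁻ _, 1 ∂(Measure.pi fun _ : Fin n => P.fst) := by
        gcongr with X
        -- The `A σ` are disjoint, so summing over permutations costs no factor.
        rw [Finset.sum_eq_single (Tuple.sort fun j => dist (X j) x)]
        · exact Set.indicator_le_self' (f := 1) (fun _ _ => zero_le) X
        · exact fun σ _ hσ => Set.indicator_of_notMem (fun hX => hσ hX.1.symm) _
        · simp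
    _ = _ := by simp

/-! ### Excess risk and the margin condition -/

theorem measurable_bayesClassifier {η : Covariate d → ℝ} (hη : Measurable η) :
    Measurable (bayesClassifier η) :=
  Measurable.ite (measurableSet_le hη measurable_const) measurable_const measurable_const

namespace IsRegressionFunction

variable {Q : Measure (Observation d)} [IsProbabilityMeasure Q] {η : Covariate d → ℝ}

theorem misclassificationRisk_eq (h : IsRegressionFunction Q η) {f : Covariate d → Fin 2}
    (hf : Measurable f) :
    misclassificationRisk Q f = ∫ x, (if f x = 1 then 1 - η x else η x) ∂Q.fst := by
  have hS : MeasurableSet {z : Observation d | f z.1 ≠ z.2} :=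
    (measurableSet_eq_fun (hf.comp measurable_fst) measurable_snd).compl
  have hf1 : MeasurableSet {x | f x = 1} := hf (measurableSet_singleton 1)
  rw [misclassificationRisk, measureReal_def, ← lintegral_indicator_one hS,
    h.lintegral_eq (measurable_one.indicator hS), integral_eq_lintegral_of_nonneg_ae]
  · congr 1
    refine lintegral_congr fun x => ?_
    rcases Fin.exists_fin_two.1 ⟨f x, rfl⟩ with hx | hx <;> simp [Set.indicator, hx]
  · refine Filter.Eventually.of_forall fun x => ?_
    have := h.mem_Icc x
    simp only [Pi.zero_apply]
    split_ifs
    · exact h.one_sub_nonneg x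
    · exact this.1
  · exact (Measurable.ite hf1 (measurable_const.sub h.measurable) h.measurable).aestronglyMeasurable

/-- The conditional errors `η x` and `1 - η x` of the two labels differ by `|2 * η x - 1|`, and the
Bayes label has the smaller one. -/
theorem excessRisk_eq (h : IsRegressionFunction Q η) {f : Covariate d → Fin 2}
    (hf : Measurable f) :
    excessRisk Q η f
      = ∫ x, |2 * η x - 1| * (if f x = bayesClassifier η x then 0 else 1) ∂Q.fst := by
  have hint : ∀ f : Covariate d → Fin 2, Measurable f →
      Integrable (fun x => if f x = 1 then 1 - η x else η x) Q.fst := by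
    intro f hf
    refine Integrable.of_mem_Icc 0 1 (Measurable.ite (hf (measurableSet_singleton 1))
      (measurable_const.sub h.measurable) h.measurable).aemeasurable
      (Filter.Eventually.of_forall fun x => ?_)
    have := h.mem_Icc x
    split_ifs
    · exact ⟨h.one_sub_nonneg x, by linarith [this.1]⟩
    · exact this
  rw [excessRisk, h.misclassificationRisk_eq hf,
    h.misclassificationRisk_eq (measurable_bayesClassifier h.measurable),
    ← integral_sub (hint _ hf) (hint _ (measurable_bayesClassifier h.measurable))]
  refine integral_congr_ae (Filter.Eventually.of_forall fun x => ?_)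
  beta_reduce
  rcases le_or_gt (η x) (1 / 2) with hx | hx
  · have hb : bayesClassifier η x = 0 := if_pos hx
    rw [abs_of_nonpos (by linarith)]
    rcases Fin.exists_fin_two.1 ⟨f x, rfl⟩ with hf | hf <;> simp [hf, hb]
    ring
  · have hb : bayesClassifier η x = 1 := if_neg (not_le.2 hx)
    rw [abs_of_nonneg (by linarith)]
    rcases Fin.exists_fin_two.1 ⟨f x, rfl⟩ with hf | hf <;> simp [hf, hb]
    ring

/-- The expected excess risk of a random classifier. -/
theorem integral_excessRisk (h : IsRegressionFunction Q η) {Ω : Type*} [MeasurableSpace Ω]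
    (μ : Measure Ω) [IsProbabilityMeasure μ] {F : Ω → Covariate d → Fin 2}
    (hF : Measurable fun p : Ω × Covariate d => F p.1 p.2) :
    Integrable (fun ω => excessRisk Q η (F ω)) μ ∧
      ∫ ω, excessRisk Q η (F ω) ∂μ
        = ∫ x, |2 * η x - 1| * μ.real {ω | F ω x ≠ bayesClassifier η x} ∂Q.fst := by
  have hFω : ∀ ω, Measurable (F ω) := fun ω => hF.comp measurable_prodMk_left
  have hFx : ∀ x, Measurable fun ω => F ω x := fun x => hF.comp measurable_prodMk_right
  set G : Ω → Covariate d → ℝ := fun ω x =>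
    |2 * η x - 1| * (if F ω x = bayesClassifier η x then 0 else 1) with hG
  have hGm : Measurable (Function.uncurry G) := by
    have hη := h.measurable
    have hb := measurable_bayesClassifier hη
    refine Measurable.mul (by fun_prop) (Measurable.ite ?_ measurable_const measurable_const)
    exact measurableSet_eq_fun hF (hb.comp measurable_snd)
  have hG1 : ∀ p, Function.uncurry G p ∈ Set.Icc (0 : ℝ) 1 := by
    rintro ⟨ω, x⟩
    have := h.mem_Icc x
    have h1 : |2 * η x - 1| ≤ 1 := abs_le.2 ⟨by linarith [this.1], by linarith [this.2]⟩
    simp only [Function.uncurry, hG]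
    split_ifs
    · simp
    · simpa using h1
  have hGi : Integrable (Function.uncurry G) (μ.prod Q.fst) :=
    Integrable.of_mem_Icc 0 1 hGm.aemeasurable (Filter.Eventually.of_forall hG1)
  simp_rw [h.excessRisk_eq (hFω _)]
  refine ⟨hGi.integral_prod_left, ?_⟩
  rw [integral_integral_swap hGi]
  refine integral_congr_ae (Filter.Eventually.of_forall fun x => ?_)
  have hS : MeasurableSet {ω | F ω x ≠ bayesClassifier η x} :=
    (hFx x (measurableSet_singleton _)).compl
  simp only [hG]
  rw [integral_const_mul, ← integral_indicator_one hS]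
  congr 1
  refine integral_congr_ae (Filter.Eventually.of_forall fun ω => ?_)
  by_cases hω : F ω x = bayesClassifier η x <;> simp [Set.indicator, hω]

end IsRegressionFunction

theorem measurable_multiKNNClassifier {m nQ : ℕ} {nP : Fin m → ℕ} (β : ℝ) (γ : Fin m → ℝ) :
    Measurable fun p : ((Fin nQ → Observation d) × ((i : Fin m) → Fin (nP i) → Observation d))
      × Covariate d => multiKNNClassifier β γ p.1.1 p.1.2 p.2 := by
  unfold multiKNNClassifier weightedKNNEstimator
  refine Measurable.ite (measurableSet_lt measurable_const ?_) measurable_const measurable_const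
  refine Measurable.div_const (Measurable.add ?_ ?_) _
  · exact (Measurable.neighborLabelSum (by fun_prop) (by fun_prop) _).const_mul _
  · exact Finset.measurable_fun_sum _ fun i _ =>
      (Measurable.neighborLabelSum (by fun_prop) (by fun_prop) _).const_mul _

/-- Integral of a margin times an error probability that decays polynomially in the margin. -/
theorem integral_mul_le_of_margin {X : Type*} [MeasurableSpace X] (ν : Measure X)
    [IsProbabilityMeasure ν] {D π : X → ℝ} (hD : Measurable D) (hD0 : ∀ x, 0 ≤ D x)
    (hπ : Measurable π) (hπ0 : ∀ x, 0 ≤ π x) (hπ1 : ∀ x, π x ≤ 1) {α Cα A δ : ℝ} (hα : 0 ≤ α)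
    (hCα : 0 < Cα) (hA : 0 < A) (hδ : 0 < δ)
    (hmargin : ∀ t, 0 < t → ν.real {x | D x < t} ≤ Cα * t ^ α)
    (hdecay : ∀ᵐ x ∂ν, 0 < D x → π x ≤ A * (D x / δ) ^ (-(α + 2))) :
    ∫ x, D x * π x ∂ν ≤ 2 * (A * 2 ^ (α + 2) + 1) * Cα * δ ^ (1 + α) := by
  -- The factor `2 ^ (α + 2)` pays for replacing `2 ^ n` by `2 ^ (n + 1)` in the decay bound; the
  -- `1` covers `D < δ`, where only `π ≤ 1` is used.
  set A' := A * 2 ^ (α + 2) + 1 with hA'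
  have hA'0 : 0 < A' := by positivity
  set a : ℕ → ℝ := fun j => A' * δ * ((2 : ℝ) ^ j) ^ (-(1 + α)) with ha
  have ha0 : ∀ j, 0 ≤ a j := fun j => by positivity
  have hset : ∀ j : ℕ, MeasurableSet {x | D x < 2 ^ j * δ} := fun j =>
    measurableSet_lt hD measurable_const
  rw [integral_eq_lintegral_of_nonneg_ae
    (Filter.Eventually.of_forall fun x => mul_nonneg (hD0 x) (hπ0 x))
    (hD.mul hπ).aestronglyMeasurable]
  refine ENNReal.toReal_le_of_le_ofReal (by positivity) ?_
  -- Nested sublevel sets replace dyadic shells, because the margin condition bounds their mass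
  -- directly; one term of the series already dominates.
  have hpt : ∀ᵐ x ∂ν, ENNReal.ofReal (D x * π x) ≤
      ∑' j : ℕ, ({x | D x < 2 ^ j * δ} : Set X).indicator (fun _ => ENNReal.ofReal (a j)) x := by
    filter_upwards [hdecay] with x hx
    suffices ∃ j : ℕ, D x < 2 ^ j * δ ∧ D x * π x ≤ a j by
      obtain ⟨j, hj, hle⟩ := this
      refine le_trans ?_ (ENNReal.le_tsum j)
      rw [Set.indicator_of_mem (by exact hj)]
      exact ENNReal.ofReal_le_ofReal hle
    rcases lt_or_ge (D x) δ with hlt | hge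
    · refine ⟨0, by simpa using hlt, ?_⟩
      simp only [ha, pow_zero, Real.one_rpow, mul_one]
      have h1 : 1 ≤ A' := by
        have : 0 < A * (2 : ℝ) ^ (α + 2) := by positivity
        linarith
      nlinarith [hD0 x, hπ0 x, hπ1 x]
    · obtain ⟨n, hn, hn'⟩ := exists_nat_pow_near ((one_le_div hδ).2 hge) (by norm_num : (1 : ℝ) < 2)
      rw [div_lt_iff₀ hδ] at hn'
      refine ⟨n + 1, hn', ?_⟩
      have hx' := hx (hδ.trans_le hge)
      have h2 : (D x / δ) ^ (-(α + 2)) ≤ ((2 : ℝ) ^ n) ^ (-(α + 2)) :=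
        Real.rpow_le_rpow_of_nonpos (by positivity) hn (by linarith)
      have h3 : ((2 : ℝ) ^ n) ^ (-(α + 2)) = 2 ^ (α + 2) * ((2 : ℝ) ^ (n + 1)) ^ (-(α + 2)) := by
        rw [pow_succ, Real.mul_rpow (by positivity) (by positivity), mul_left_comm,
          ← Real.rpow_add (by norm_num)]
        simp
      have h4 : ((2 : ℝ) ^ (n + 1)) * ((2 : ℝ) ^ (n + 1)) ^ (-(α + 2))
          = ((2 : ℝ) ^ (n + 1)) ^ (-(1 + α)) := by
        conv_lhs => rw [← Real.rpow_one_add' (by positivity) (by linarith)]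
        ring_nf
      calc D x * π x ≤ (2 ^ (n + 1) * δ) * (A * (2 ^ (α + 2) * ((2 : ℝ) ^ (n + 1)) ^ (-(α + 2)))) := by
            refine mul_le_mul hn'.le (hx'.trans ?_) (hπ0 x) (by positivity)
            rw [← h3]
            gcongr
        _ = (A * 2 ^ (α + 2)) * δ * ((2 : ℝ) ^ (n + 1) * ((2 : ℝ) ^ (n + 1)) ^ (-(α + 2))) := by ring
        _ ≤ a (n + 1) := by
            rw [h4]
            simp only [ha]
            gcongr
            linarith
  calc ∫⁻ x, ENNReal.ofReal (D x * π x) ∂ν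
      ≤ ∫⁻ x, ∑' j : ℕ, ({x | D x < 2 ^ j * δ} : Set X).indicator
          (fun _ => ENNReal.ofReal (a j)) x ∂ν := lintegral_mono_ae hpt
    _ = ∑' j : ℕ, ENNReal.ofReal (a j) * ν {x | D x < 2 ^ j * δ} := by
        rw [lintegral_tsum fun j => (measurable_const.indicator (hset j)).aemeasurable]
        exact tsum_congr fun j => lintegral_indicator_const (hset j) _
    _ ≤ ∑' j : ℕ, ENNReal.ofReal (A' * Cα * δ ^ (1 + α) * (1 / 2) ^ j) := by
        refine ENNReal.tsum_le_tsum fun j => ?_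
        rw [← ofReal_measureReal, ← ENNReal.ofReal_mul (ha0 j)]
        refine ENNReal.ofReal_le_ofReal ?_
        refine (mul_le_mul_of_nonneg_left (hmargin _ (by positivity)) (ha0 j)).trans_eq ?_
        simp only [ha]
        have h5 : ((2 : ℝ) ^ j) ^ (-(1 + α)) * ((2 : ℝ) ^ j) ^ α = (1 / 2) ^ j := by
          rw [← Real.rpow_add (by positivity)]
          simp [Real.rpow_neg_one]
        rw [Real.mul_rpow (by positivity) hδ.le, Real.rpow_add hδ, Real.rpow_one, ← h5]
        ring
    _ = ENNReal.ofReal (2 * A' * Cα * δ ^ (1 + α)) := by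
        rw [← ENNReal.ofReal_tsum_of_nonneg (fun j => by positivity)
          (summable_geometric_two.mul_left _), tsum_mul_left, tsum_geometric_two]
        ring_nf

/-! ### Ball masses and the wrong-sign event -/

/-- A closed ball centred in a regular support has mass at least of the order of its volume. -/
theorem HasDensityBetween.le_real_closedBall {μlo μhi cμ : ℝ} {ν : Measure (Covariate d)}
    [IsFiniteMeasure ν] (h : HasDensityBetween μlo μhi ν) (hμlo : 0 ≤ μlo) (hcμ : 0 ≤ cμ)
    {x : Covariate d} {r : ℝ} (hr : 0 ≤ r)
    (hreg : ENNReal.ofReal cμ * volume (Metric.closedBall x r)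
      ≤ volume (ν.support ∩ Metric.closedBall x r)) :
    μlo * cμ * (volume : Measure (Covariate d)).real (Metric.ball 0 1) * r ^ d
      ≤ ν.real (Metric.closedBall x r) := by
  have hms : MeasurableSet (ν.support ∩ Metric.closedBall x r) :=
    (Measure.isClosed_support.inter Metric.isClosed_closedBall).measurableSet
  have h1 : ENNReal.ofReal μlo * volume (ν.support ∩ Metric.closedBall x r)
      ≤ ν (Metric.closedBall x r) := by
    calc _ = ∫⁻ _ in ν.support ∩ Metric.closedBall x r, ENNReal.ofReal μlo := by
          rw [setLIntegral_const]
      _ ≤ ∫⁻ y in ν.support ∩ Metric.closedBall x r, ν.rnDeriv volume y :=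
          setLIntegral_mono_ae' hms (h.2.mono fun y hy hyS => (hy hyS.1).1.le)
      _ ≤ ν (ν.support ∩ Metric.closedBall x r) := Measure.setLIntegral_rnDeriv_le _
      _ ≤ _ := measure_mono Set.inter_subset_right
  have h2 : ENNReal.ofReal (μlo * cμ * (volume : Measure (Covariate d)).real (Metric.ball 0 1)
      * r ^ d) ≤ ν (Metric.closedBall x r) := by
    refine le_trans (le_of_eq ?_) ((mul_le_mul_right hreg _).trans h1)
    rw [Measure.addHaar_closedBall _ _ hr, finrank_euclideanSpace_fin,
      ← ofReal_measureReal (μ := volume) (s := Metric.ball (0 : Covariate d) 1) (h := measure_ball_lt_top.ne),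
      ← ENNReal.ofReal_mul (by positivity), ← ENNReal.ofReal_mul hcμ, ← ENNReal.ofReal_mul hμlo]
    ring_nf
  exact (ENNReal.ofReal_le_iff_le_toReal (measure_ne_top _ _)).1 h2

/-- With high probability, the `k` nearest sample points lie in a ball of large enough mass. -/
theorem measure_card_dist_lt_le (P : Measure (Observation d)) [IsProbabilityMeasure P] (n k : ℕ)
    (x : Covariate d) {r v : ℝ} (hv : k * v ≤ n * P.fst.real (Metric.closedBall x r)) :
    (Measure.pi fun _ : Fin n => P) {S | k ≤ (Finset.univ.filter fun j => dist (S j).1 x ≤ r).card}ᶜ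
      ≤ ENNReal.ofReal (Real.exp (1 - v / 2)) := by
  classical
  rcases Nat.eq_zero_or_pos k with rfl | hk
  · simp
  -- For `v ≤ 2` the bound is at least `1`. For `v > 2`, Chernoff gives the exponent `k * (1 -
  -- v/2)`, which is at most `1 - v/2` since `k ≥ 1`.
  rcases le_or_gt v 2 with hv2 | hv2
  · refine prob_le_one.trans ?_
    rw [ENNReal.one_le_ofReal, Real.one_le_exp_iff]
    linarith
  have hB : MeasurableSet (Prod.fst ⁻¹' Metric.closedBall x r : Set (Observation d)) :=
    measurable_fst Metric.isClosed_closedBall.measurableSet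
  have h := measure_card_mem_lt_le P hB n k
  have hP : P.fst.real (Metric.closedBall x r) = P.real (Prod.fst ⁻¹' Metric.closedBall x r) :=
    map_measureReal_apply measurable_fst Metric.isClosed_closedBall.measurableSet
  refine (measure_mono fun S hS => ?_).trans (h.trans (ENNReal.ofReal_le_ofReal
    (Real.exp_le_exp.2 ?_)))
  · simp only [Set.mem_compl_iff, Set.mem_ofPred_eq, not_le] at hS ⊢
    refine lt_of_le_of_lt (le_of_eq (congrArg Finset.card ?_)) hS
    ext j
    simp
  · rw [← hP]
    have : (1 : ℝ) ≤ k := by exact_mod_cast hk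
    nlinarith

instance sampleLaw.isProbabilityMeasure {m nQ : ℕ} {nP : Fin m → ℕ}
    {P : Fin m → Measure (Observation d)} {Q : Measure (Observation d)}
    [∀ i, IsProbabilityMeasure (P i)] [IsProbabilityMeasure Q] :
    IsProbabilityMeasure (sampleLaw nQ nP P Q) := by
  unfold sampleLaw
  infer_instance

/-- Probability that the centred weighted label sum of the nearest neighbours of `x` has the wrong
sign. -/
theorem sampleLaw_wrong_sign_le {m nQ : ℕ} {nP : Fin m → ℕ}
    {P : Fin m → Measure (Observation d)} {Q : Measure (Observation d)}
    [∀ i, IsProbabilityMeasure (P i)] [IsProbabilityMeasure Q]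
    {ηP : Fin m → Covariate d → ℝ} {ηQ : Covariate d → ℝ}
    (hP : ∀ i, IsRegressionFunction (P i) (ηP i)) (hQ : IsRegressionFunction Q ηQ)
    (x : Covariate d) {r v t sgn aQ wQ : ℝ} {aP wP : Fin m → ℝ} (kQ : ℕ) (kP : Fin m → ℕ)
    (ht : 0 ≤ t) (hsgn : sgn ^ 2 = 1) (hwQ : 0 ≤ wQ) (hwP : ∀ i, 0 ≤ wP i)
    (hvQ : kQ * v ≤ nQ * Q.fst.real (Metric.closedBall x r))
    (hvP : ∀ i, kP i * v ≤ nP i * (P i).fst.real (Metric.closedBall x r))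
    (haQ : ∀ y ∈ Q.fst.support, dist y x ≤ r → aQ ≤ sgn * (ηQ y - 1 / 2))
    (haP : ∀ i, ∀ y ∈ (P i).fst.support, dist y x ≤ r → aP i ≤ sgn * (ηP i y - 1 / 2))
    (hVQ : wQ ^ 2 * kQ ≤ 1) (hVP : ∀ i, wP i ^ 2 * kP i ≤ 1) :
    sampleLaw nQ nP P Q {Z | sgn * (wQ * (neighborLabelSum Z.1 kQ x - kQ / 2)
        + ∑ i, wP i * (neighborLabelSum (Z.2 i) (kP i) x - kP i / 2)) ≤ 0}
      ≤ ENNReal.ofReal ((m + 1) * Real.exp (1 - v / 2)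
        + Real.exp (-(t * (wQ * kQ * aQ + ∑ i, wP i * kP i * aP i)) + t ^ 2 * (m + 1) / 8)) := by
  set EQ : Set (Fin nQ → Observation d) :=
    {S | kQ ≤ (Finset.univ.filter fun j => dist (S j).1 x ≤ r).card} with hEQ
  set EP : ∀ i, Set (Fin (nP i) → Observation d) := fun i =>
    {S | kP i ≤ (Finset.univ.filter fun j => dist (S j).1 x ≤ r).card} with hEP
  have hEQm : MeasurableSet EQ := measurableSet_le_card_dist_fst_le nQ kQ x r
  have hEPm : ∀ i, MeasurableSet (EP i) := fun i =>
    measurableSet_le_card_dist_fst_le (nP i) (kP i) x r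
  -- The exponentials are truncated to the good events, since the label biases are controlled only
  -- inside the ball.
  set φQ : (Fin nQ → Observation d) → ENNReal := EQ.indicator fun S =>
    ENNReal.ofReal (Real.exp (-((t * sgn * wQ) * (neighborLabelSum S kQ x - kQ / 2)))) with hφQ
  set φP : ∀ i, (Fin (nP i) → Observation d) → ENNReal := fun i => (EP i).indicator fun S =>
    ENNReal.ofReal (Real.exp (-((t * sgn * wP i) * (neighborLabelSum S (kP i) x - kP i / 2))))
    with hφP
  have hLm : ∀ n k, Measurable fun S : Fin n → Observation d => neighborLabelSum S k x :=
    fun n k => Measurable.neighborLabelSum measurable_id measurable_const k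
  have hφQm : Measurable φQ := by
    have := hLm nQ kQ
    exact Measurable.indicator (by fun_prop) hEQm
  have hφPm : ∀ i, Measurable (φP i) := fun i => by
    have := hLm (nP i) (kP i)
    exact Measurable.indicator (by fun_prop) (hEPm i)
  have hs2 : ∀ w, (t * sgn * w) ^ 2 = t ^ 2 * w ^ 2 := fun w => by
    rw [mul_pow, mul_pow, hsgn, mul_one]
  have hIQ : ∫⁻ S, φQ S ∂(Measure.pi fun _ : Fin nQ => Q)
      ≤ ENNReal.ofReal (Real.exp (-(t * (wQ * kQ * aQ)) + t ^ 2 / 8)) := by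
    rw [hφQ, lintegral_indicator hEQm]
    refine (hQ.lintegral_exp_neighborLabelSum_le x (b := t * wQ * aQ) nQ kQ
      fun y hy hd => ?_).trans (ENNReal.ofReal_le_ofReal (Real.exp_le_exp.2 ?_))
    · have := mul_le_mul_of_nonneg_left (haQ y hy hd) (mul_nonneg ht hwQ)
      linarith
    · rw [hs2]
      nlinarith [mul_le_mul_of_nonneg_left hVQ (sq_nonneg t)]
  have hIP : ∀ i, ∫⁻ S, φP i S ∂(Measure.pi fun _ : Fin (nP i) => P i)
      ≤ ENNReal.ofReal (Real.exp (-(t * (wP i * kP i * aP i)) + t ^ 2 / 8)) := fun i => by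
    rw [hφP, lintegral_indicator (hEPm i)]
    refine ((hP i).lintegral_exp_neighborLabelSum_le x (b := t * wP i * aP i) (nP i) (kP i)
      fun y hy hd => ?_).trans (ENNReal.ofReal_le_ofReal (Real.exp_le_exp.2 ?_))
    · have := mul_le_mul_of_nonneg_left (haP i y hy hd) (mul_nonneg ht (hwP i))
      linarith
    · rw [hs2]
      nlinarith [mul_le_mul_of_nonneg_left (hVP i) (sq_nonneg t)]
  set BQ : Set ((Fin nQ → Observation d) × ((i : Fin m) → Fin (nP i) → Observation d)) :=
    Prod.fst ⁻¹' EQᶜ with hBQ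
  set BP : Fin m → Set ((Fin nQ → Observation d) × ((i : Fin m) → Fin (nP i) → Observation d)) :=
    fun i => (fun Z => Z.2 i) ⁻¹' (EP i)ᶜ with hBP
  have hBQle : sampleLaw nQ nP P Q BQ ≤ ENNReal.ofReal (Real.exp (1 - v / 2)) := by
    rw [sampleLaw, hBQ, measurePreserving_fst.measure_preimage hEQm.compl.nullMeasurableSet]
    exact measure_card_dist_lt_le Q nQ kQ x hvQ
  have hBPle : ∀ i, sampleLaw nQ nP P Q (BP i) ≤ ENNReal.ofReal (Real.exp (1 - v / 2)) := by
    intro i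
    have hmp : MeasurePreserving (fun Z : (Fin nQ → Observation d) ×
        ((i : Fin m) → Fin (nP i) → Observation d) => Z.2 i) (sampleLaw nQ nP P Q)
        (Measure.pi fun _ : Fin (nP i) => P i) :=
      (measurePreserving_eval (fun i : Fin m => Measure.pi fun _ : Fin (nP i) => P i) i).comp
        measurePreserving_snd
    rw [hBP, hmp.measure_preimage (hEPm i).compl.nullMeasurableSet]
    exact measure_card_dist_lt_le (P i) (nP i) (kP i) x (hvP i)
  have hsub : {Z : (Fin nQ → Observation d) × ((i : Fin m) → Fin (nP i) → Observation d) |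
        sgn * (wQ * (neighborLabelSum Z.1 kQ x - kQ / 2)
          + ∑ i, wP i * (neighborLabelSum (Z.2 i) (kP i) x - kP i / 2)) ≤ 0}
      ⊆ (BQ ∪ ⋃ i, BP i) ∪ {Z | 1 ≤ φQ Z.1 * ∏ i, φP i (Z.2 i)} := by
    intro Z hZ
    by_cases hZQ : Z.1 ∈ EQ
    swap
    · exact Or.inl (Or.inl hZQ)
    by_cases hZP : ∀ i, Z.2 i ∈ EP i
    swap
    · push Not at hZP
      exact Or.inl (Or.inr (Set.mem_iUnion.2 hZP))
    refine Or.inr ?_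
    simp only [Set.mem_ofPred_eq] at hZ ⊢
    simp only [hφQ, hφP, Set.indicator_of_mem hZQ, Set.indicator_of_mem (hZP _)]
    rw [← ENNReal.ofReal_prod_of_nonneg (fun _ _ => Real.exp_nonneg _), ← Real.exp_sum,
      ← ENNReal.ofReal_mul (Real.exp_nonneg _), ← Real.exp_add, ENNReal.one_le_ofReal,
      Real.one_le_exp_iff, Finset.sum_neg_distrib]
    have : t * sgn * wQ * (neighborLabelSum Z.1 kQ x - kQ / 2)
        + ∑ i, t * sgn * wP i * (neighborLabelSum (Z.2 i) (kP i) x - kP i / 2)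
        = t * (sgn * (wQ * (neighborLabelSum Z.1 kQ x - kQ / 2)
          + ∑ i, wP i * (neighborLabelSum (Z.2 i) (kP i) x - kP i / 2))) := by
      rw [mul_add, mul_add, Finset.mul_sum, Finset.mul_sum]
      congr 1
      · ring
      · exact Finset.sum_congr rfl fun i _ => by ring
    nlinarith [mul_nonneg ht (neg_nonneg.2 hZ)]
  have hmarkov : sampleLaw nQ nP P Q {Z | 1 ≤ φQ Z.1 * ∏ i, φP i (Z.2 i)}
      ≤ ENNReal.ofReal (Real.exp (-(t * (wQ * kQ * aQ + ∑ i, wP i * kP i * aP i))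
        + t ^ 2 * (m + 1) / 8)) := by
    have hprodm : Measurable fun W : (i : Fin m) → Fin (nP i) → Observation d =>
        ∏ i, φP i (W i) :=
      Finset.measurable_fun_prod _ fun i _ => (hφPm i).comp (measurable_pi_apply i)
    have h1 := mul_meas_ge_le_lintegral (μ := sampleLaw nQ nP P Q)
      (f := fun Z => φQ Z.1 * ∏ i, φP i (Z.2 i)) (by fun_prop) 1
    rw [one_mul, sampleLaw, lintegral_prod_mul hφQm.aemeasurable hprodm.aemeasurable,
      lintegral_pi_prod _ hφPm] at h1
    refine h1.trans ((mul_le_mul' hIQ (Finset.prod_le_prod' fun i _ => hIP i)).trans_eq ?_)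
    rw [← ENNReal.ofReal_prod_of_nonneg (fun _ _ => Real.exp_nonneg _), ← Real.exp_sum,
      ← ENNReal.ofReal_mul (Real.exp_nonneg _), ← Real.exp_add, Finset.sum_add_distrib,
      Finset.sum_neg_distrib, ← Finset.mul_sum]
    simp only [Finset.sum_const, Finset.card_univ, Fintype.card_fin, nsmul_eq_mul]
    ring_nf
  calc _ ≤ sampleLaw nQ nP P Q ((BQ ∪ ⋃ i, BP i) ∪ {Z | 1 ≤ φQ Z.1 * ∏ i, φP i (Z.2 i)}) :=
        measure_mono hsub
    _ ≤ (sampleLaw nQ nP P Q BQ + ∑ i, sampleLaw nQ nP P Q (BP i))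
          + sampleLaw nQ nP P Q {Z | 1 ≤ φQ Z.1 * ∏ i, φP i (Z.2 i)} := by
        refine (measure_union_le _ _).trans ?_
        gcongr
        refine (measure_union_le _ _).trans ?_
        gcongr
        exact measure_iUnion_fintype_le _ _
    _ ≤ (ENNReal.ofReal (Real.exp (1 - v / 2)) + ∑ _i : Fin m, ENNReal.ofReal (Real.exp (1 - v / 2)))
          + ENNReal.ofReal (Real.exp (-(t * (wQ * kQ * aQ + ∑ i, wP i * kP i * aP i))
        + t ^ 2 * (m + 1) / 8)) := by
        gcongr with i _
        exact hBPle i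
    _ = _ := by
        rw [← ENNReal.ofReal_sum_of_nonneg (fun _ _ => Real.exp_nonneg _),
          ← ENNReal.ofReal_add (by positivity) (by positivity),
          ← ENNReal.ofReal_add (by positivity) (by positivity)]
        simp only [Finset.sum_const, Finset.card_univ, Fintype.card_fin, nsmul_eq_mul]
        ring_nf

/-- With `q = p / κ` and `y = c * u ^ κ`, raise `y / q ≤ exp (y / q)` to the power `-q`. -/
theorem exists_exp_neg_mul_rpow_le {c κ p : ℝ} (hc : 0 < c) (hκ : 0 < κ) (hp : 0 < p) :
    ∃ A : ℝ, 0 < A ∧ ∀ u : ℝ, 0 < u → Real.exp (-(c * u ^ κ)) ≤ A * u ^ (-p) := by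
  have hq : 0 < p / κ := by positivity
  refine ⟨(c / (p / κ)) ^ (-(p / κ)), by positivity, fun u hu => ?_⟩
  have hy : 0 < c * u ^ κ / (p / κ) := by positivity
  have h1 : c * u ^ κ / (p / κ) ≤ Real.exp (c * u ^ κ / (p / κ)) := by
    linarith [Real.add_one_le_exp (c * u ^ κ / (p / κ))]
  calc Real.exp (-(c * u ^ κ)) = (Real.exp (c * u ^ κ / (p / κ))) ^ (-(p / κ)) := by
        rw [← Real.exp_mul]
        congr 1
        field_simp
    _ ≤ (c * u ^ κ / (p / κ)) ^ (-(p / κ)) := Real.rpow_le_rpow_of_nonpos hy h1 (by linarith)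
    _ = (c / (p / κ)) ^ (-(p / κ)) * u ^ (-p) := by
        rw [mul_div_right_comm, Real.mul_rpow (by positivity) (by positivity), ← Real.rpow_mul hu.le]
        congr 2
        field_simp

/-! ### Calibration of weights and neighbour counts -/

section Weights

variable {β γ N : ℝ} {n : ℕ}

theorem floor_count_mul_le (hN : 0 < N) (a : ℝ) :
    (⌊(n : ℝ) * N ^ (-a)⌋₊ : ℝ) * N ^ a ≤ n := by
  have h := Nat.floor_le (show 0 ≤ (n : ℝ) * N ^ (-a) by positivity)
  calc _ ≤ (n : ℝ) * N ^ (-a) * N ^ a := by gcongr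
    _ = n := by rw [mul_assoc, ← Real.rpow_add hN]; simp

/-- The hypothesis means `n ≤ N ^ ((2γβ+d)/(2β+d))`, so the neighbour count is at most `N ^
(2γβ/(2β+d))`, the inverse square of the weight. This controls the variance of each sample's
weighted sum. -/
theorem weight_sq_mul_count_le (hβ : 0 < β) (hγ : 0 < γ) (hN : 0 < N)
    (hn : (n : ℝ) ^ ((2 * β + d) / (2 * γ * β + d)) ≤ N) :
    (N ^ (-(γ * β / (2 * β + d)))) ^ 2 * ⌊(n : ℝ) * N ^ (-((d : ℝ) / (2 * β + d)))⌋₊ ≤ 1 := by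
  have he : 0 < 2 * β + d := by positivity
  have he' : 0 < 2 * γ * β + d := by positivity
  have hn' : (n : ℝ) ≤ N ^ ((2 * γ * β + d) / (2 * β + d)) := by
    rw [← inv_div, Real.le_rpow_inv_iff_of_pos (by positivity) hN.le (by positivity)]
    exact hn
  have h := Nat.floor_le (show 0 ≤ (n : ℝ) * N ^ (-((d : ℝ) / (2 * β + d))) by positivity)
  calc _ ≤ (N ^ (-(γ * β / (2 * β + d)))) ^ 2 *
        (N ^ ((2 * γ * β + d) / (2 * β + d)) * N ^ (-((d : ℝ) / (2 * β + d)))) := by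
        gcongr
        exact h.trans (by gcongr)
    _ = 1 := by
        rw [← Real.rpow_natCast, ← Real.rpow_mul hN.le, ← Real.rpow_add hN, ← Real.rpow_add hN,
          ← Real.rpow_zero N]
        congr 1
        field_simp
        push_cast
        ring

/-- A sample that contributes a fixed proportion of the effective sample size contributes a
large signal. -/
theorem exists_weight_mul_count_ge (d : ℕ) {C M : ℝ} (hβ : 0 < β) (hγ : 0 < γ) (hC : 0 < C)
    (hM : 0 < M) : ∃ c U : ℝ, 0 < c ∧ 0 < U ∧ ∀ (n : ℕ) (N Δ : ℝ), 0 < N → 0 < Δ → Δ ≤ 1 / 2 →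
      N ≤ M * (n : ℝ) ^ ((2 * β + d) / (2 * γ * β + d)) → U ≤ Δ * N ^ (β / (2 * β + d)) →
        c * (Δ * N ^ (β / (2 * β + d))) ^ γ
          ≤ N ^ (-(γ * β / (2 * β + d))) * ⌊(n : ℝ) * N ^ (-((d : ℝ) / (2 * β + d)))⌋₊
            * (C * (Δ / 2) ^ γ) := by
  have he : 0 < 2 * β + d := by positivity
  have he' : 0 < 2 * γ * β + d := by positivity
  set κ : ℝ := M ^ (-((2 * γ * β + d) / (2 * β + d))) with hκ
  have hκ0 : 0 < κ := by positivity
  -- The threshold `U` forces `κ * ρ ^ (2 * γ) ≥ 1`. The neighbour count is then nonzero, and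
  -- rounding down loses at most a factor two.
  refine ⟨κ / 2 * (C * (1 / 2) ^ γ), κ ^ (-(1 / (2 * γ))), by positivity, by positivity,
    fun n N Δ hN hΔ hΔ2 hn hU => ?_⟩
  set ρ : ℝ := N ^ (β / (2 * β + d)) with hρ
  have hρ0 : 0 < ρ := by positivity
  have hw : N ^ (-(γ * β / (2 * β + d))) = ρ ^ (-γ) := by
    rw [hρ, ← Real.rpow_mul hN.le]
    congr 1
    field_simp
  have hn' : κ * N ^ ((2 * γ * β + d) / (2 * β + d)) ≤ n := by
    have h1 : (M⁻¹ * N) ≤ (n : ℝ) ^ ((2 * β + d) / (2 * γ * β + d)) := by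
      rw [inv_mul_le_iff₀ hM]
      exact hn
    have h2 : (M⁻¹ * N) ^ ((2 * γ * β + d) / (2 * β + d)) ≤ n := by
      rw [← inv_div, Real.rpow_inv_le_iff_of_pos (by positivity) (by positivity) (by positivity)]
      exact h1
    refine le_of_eq_of_le ?_ h2
    rw [Real.mul_rpow (by positivity) hN.le, hκ, Real.inv_rpow hM.le, Real.rpow_neg hM.le]
  have hy : κ * ρ ^ (2 * γ) ≤ (n : ℝ) * N ^ (-((d : ℝ) / (2 * β + d))) := by
    refine le_of_eq_of_le ?_ (mul_le_mul_of_nonneg_right hn' (by positivity))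
    rw [mul_assoc, ← Real.rpow_add hN, hρ, ← Real.rpow_mul hN.le]
    congr 2
    field_simp
    ring
  have hy1 : 1 ≤ κ * ρ ^ (2 * γ) := by
    have hρU : κ ^ (-(1 / (2 * γ))) ≤ ρ := by nlinarith
    calc 1 = κ * (κ ^ (-(1 / (2 * γ)))) ^ (2 * γ) := by
          rw [← Real.rpow_mul hκ0.le]
          have : -(1 / (2 * γ)) * (2 * γ) = -1 := by field_simp
          rw [this, Real.rpow_neg_one, mul_inv_cancel₀ hκ0.ne']
      _ ≤ _ := by gcongr
  have hfloor : κ / 2 * ρ ^ (2 * γ) ≤ ⌊(n : ℝ) * N ^ (-((d : ℝ) / (2 * β + d)))⌋₊ := by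
    set y : ℝ := (n : ℝ) * N ^ (-((d : ℝ) / (2 * β + d)))
    have h1 : (1 : ℝ) ≤ ⌊y⌋₊ := by exact_mod_cast Nat.le_floor (by simpa using hy1.trans hy)
    have h2 := Nat.lt_floor_add_one y
    linarith
  rw [hw]
  calc κ / 2 * (C * (1 / 2) ^ γ) * (Δ * ρ) ^ γ
      = ρ ^ (-γ) * (κ / 2 * ρ ^ (2 * γ)) * (C * (Δ / 2) ^ γ) := by
        have h1 : ρ ^ (2 * γ) = ρ ^ γ * ρ ^ γ := by rw [← Real.rpow_add hρ0]; ring_nf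
        have h2 : ρ ^ (-γ) * ρ ^ γ = 1 := by rw [← Real.rpow_add hρ0]; simp
        rw [Real.mul_rpow hΔ.le hρ0.le, h1, div_eq_mul_one_div Δ, Real.mul_rpow hΔ.le (by norm_num)]
        linear_combination (-(κ / 2 * C * (1 / 2) ^ γ * Δ ^ γ * ρ ^ γ)) * h2
    _ ≤ _ := by gcongr

end Weights

theorem effectiveSize_pos {m : ℕ} {β : ℝ} {γ : Fin m → ℝ} {nQ : ℕ} {nP : Fin m → ℕ}
    (h : 0 < nQ + ∑ i, nP i) : 0 < effectiveSize d β γ nQ nP := by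
  unfold effectiveSize
  have h0 : ∀ i, 0 ≤ (nP i : ℝ) ^ ((2 * β + d) / (2 * γ i * β + d)) := fun i => by positivity
  rcases Nat.eq_zero_or_pos nQ with hQ | hQ
  · obtain ⟨i, _, hi⟩ : ∃ i ∈ Finset.univ, nP i ≠ 0 := by
      by_contra! hcon
      rw [hQ, Finset.sum_eq_zero hcon] at h
      exact absurd h (by norm_num)
    have : 0 < (nP i : ℝ) := by exact_mod_cast Nat.pos_of_ne_zero hi
    exact add_pos_of_nonneg_of_pos (by positivity)
      (Finset.sum_pos' (fun i _ => h0 i) ⟨i, Finset.mem_univ i, by positivity⟩)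
  · have : 0 < (nQ : ℝ) := by exact_mod_cast hQ
    exact add_pos_of_pos_of_nonneg this (Finset.sum_nonneg fun i _ => h0 i)

/-! ### Error probability at a point -/

/-- A misclassified point forces the centred weighted label sum to have the wrong sign. -/
theorem wrong_sign_of_multiKNNClassifier_ne {m nQ : ℕ} {nP : Fin m → ℕ} {β : ℝ} {γ : Fin m → ℝ}
    {η : Covariate d → ℝ} {x : Covariate d} {SQ : Fin nQ → Observation d}
    {SP : (i : Fin m) → Fin (nP i) → Observation d} {N : ℝ}
    (hN : effectiveSize d β γ nQ nP = N) (hN0 : 0 < N)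
    (hne : multiKNNClassifier β γ SQ SP x ≠ bayesClassifier η x) :
    (if η x ≤ 1 / 2 then -1 else 1) *
      (N ^ (-(β / (2 * β + d))) * (neighborLabelSum SQ ⌊(nQ : ℝ) * N ^ (-((d : ℝ) / (2 * β + d)))⌋₊ x
          - (⌊(nQ : ℝ) * N ^ (-((d : ℝ) / (2 * β + d)))⌋₊ : ℝ) / 2)
        + ∑ i, N ^ (-(γ i * β / (2 * β + d))) *
          (neighborLabelSum (SP i) ⌊(nP i : ℝ) * N ^ (-((d : ℝ) / (2 * β + d)))⌋₊ x
          - (⌊(nP i : ℝ) * N ^ (-((d : ℝ) / (2 * β + d)))⌋₊ : ℝ) / 2)) ≤ 0 := by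
  simp only [multiKNNClassifier, hN, weightedKNNEstimator] at hne
  set kQ : ℕ := ⌊(nQ : ℝ) * N ^ (-((d : ℝ) / (2 * β + d)))⌋₊
  set kP : Fin m → ℕ := fun i => ⌊(nP i : ℝ) * N ^ (-((d : ℝ) / (2 * β + d)))⌋₊ with hkP
  set wQ : ℝ := N ^ (-(β / (2 * β + d)))
  set wP : Fin m → ℝ := fun i => N ^ (-(γ i * β / (2 * β + d))) with hwP
  have hwQ : 0 < wQ := by positivity
  have hwP0 : ∀ i, 0 < wP i := fun i => by positivity
  change (if η x ≤ 1 / 2 then (-1 : ℝ) else 1) * (wQ * (neighborLabelSum SQ kQ x - (kQ : ℝ) / 2)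
        + ∑ i, wP i * (neighborLabelSum (SP i) (kP i) x - (kP i : ℝ) / 2)) ≤ 0
  set L : ℝ := wQ * neighborLabelSum SQ kQ x + ∑ i, wP i * neighborLabelSum (SP i) (kP i) x with hL
  set W : ℝ := wQ * kQ + ∑ i, wP i * kP i with hW
  have hLW : wQ * (neighborLabelSum SQ kQ x - (kQ : ℝ) / 2)
        + ∑ i, wP i * (neighborLabelSum (SP i) (kP i) x - (kP i : ℝ) / 2) = L - W / 2 := by
    have : ∀ i, wP i * (neighborLabelSum (SP i) (kP i) x - (kP i : ℝ) / 2)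
        = wP i * neighborLabelSum (SP i) (kP i) x - wP i * kP i / 2 := fun i => by ring
    simp only [hL, hW, this, Finset.sum_sub_distrib, ← Finset.sum_div]
    ring
  have hW0' : ∀ i, 0 ≤ wP i * (kP i : ℝ) := fun i => by have := hwP0 i; positivity
  have hW0 : 0 ≤ W := add_nonneg (by positivity) (Finset.sum_nonneg fun i _ => hW0' i)
  rw [hLW]
  -- If the denominator vanishes, all counts are zero and so is the centred sum; the non-strict
  -- inequality holds whatever the classifier outputs.
  rcases hW0.eq_or_lt with hWz | hWpos
  · have hs : 0 ≤ ∑ i, wP i * (kP i : ℝ) := Finset.sum_nonneg fun i _ => hW0' i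
    have hq : 0 ≤ wQ * (kQ : ℝ) := by positivity
    have hkQ : kQ = 0 := by
      have h0 : wQ * (kQ : ℝ) = 0 := by linarith
      exact_mod_cast (mul_eq_zero.1 h0).resolve_left hwQ.ne'
    have hkP0 : ∀ i, kP i = 0 := fun i => by
      have h0 : ∑ i, wP i * (kP i : ℝ) = 0 := by linarith
      have h1 := (Finset.sum_eq_zero_iff_of_nonneg fun i _ => hW0' i).1 h0 i (Finset.mem_univ i)
      exact_mod_cast (mul_eq_zero.1 h1).resolve_left (hwP0 i).ne'
    have hL0 : L = 0 := by simp [hL, hkQ, hkP0, neighborLabelSum]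
    rw [hL0, ← hWz]
    simp
  · simp only [lt_div_iff₀ hWpos] at hne
    by_cases hη : η x ≤ 1 / 2
    · rw [if_pos hη]
      by_cases hc : 1 / 2 * W < L
      · linarith
      · exact absurd (by rw [if_neg hc]; exact (if_pos hη).symm) hne
    · rw [if_neg hη]
      by_cases hc : 1 / 2 * W < L
      · exact absurd (by rw [if_pos hc]; exact (if_neg hη).symm) hne
      · linarith

/-- The regression functions stay away from `1 / 2` on a neighbourhood of `x` whose radius depends
on the margin at `x`. -/
theorem HolderSmoothOn.half_margin_le {β Cβ : ℝ} {Ω : Set (Covariate d)} {η : Covariate d → ℝ}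
    (h : HolderSmoothOn β Cβ Ω η) (hβ : 0 < β) (hCβ : 0 < Cβ) {x y : Covariate d} (hx : x ∈ Ω)
    (hy : y ∈ Ω) {r : ℝ} (hxy : dist y x ≤ r) (hr : Cβ * r ^ β ≤ |η x - 1 / 2| / 2) :
    |η x - 1 / 2| / 2 ≤ (if η x ≤ 1 / 2 then -1 else 1) * (η y - 1 / 2) := by
  have h1 : |η y - η x| ≤ |η x - 1 / 2| / 2 := by
    refine (h y hy x hx).trans (le_trans ?_ hr)
    rw [← dist_eq_norm]
    gcongr
  have h2 := abs_le.1 h1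
  split_ifs with hη
  · rw [abs_of_nonpos (by linarith)] at h2 ⊢
    linarith [h2.2]
  · rw [abs_of_nonneg (by linarith)] at h2 ⊢
    linarith [h2.1]

/-- Since `b` has the strict sign `sgn` and `a * b ≥ 0`, `|a| = sgn * a`. Used with `a` the source
bias and `b` the target bias. -/
theorem le_mul_of_signal {a b c sgn : ℝ} (hsgn : sgn = -1 ∨ sgn = 1) (hb : 0 < sgn * b)
    (hab : 0 ≤ a * b) (hc : c ≤ |a|) : c ≤ sgn * a := by
  rcases hsgn with rfl | rfl
  · have hb' : b < 0 := by linarith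
    rw [abs_of_nonpos (by nlinarith)] at hc
    linarith
  · have hb' : 0 < b := by linarith
    rw [abs_of_nonneg (by nlinarith)] at hc
    linarith

/-- The error probability of the classifier at a point decays polynomially in the ratio of the
margin at that point to `N ^ (-β / (2β + d))`. -/
theorem exists_error_probability_le (d m : ℕ) (hd : 1 ≤ d) (hm : 1 ≤ m)
    (α Cα β Cβ : ℝ) (hα : 0 ≤ α) (hβ : 0 < β) (hCβ : 0 < Cβ)
    (γ Cγ : Fin m → ℝ) (hγ : ∀ i, 0 < γ i) (hCγ : ∀ i, 0 < Cγ i)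
    (μlo μhi cμ rμ : ℝ) (hμlo : 0 < μlo) (hcμ : 0 < cμ) (hrμ : 0 < rμ) :
    ∃ A : ℝ, 0 < A ∧ ∀ (nQ : ℕ) (nP : Fin m → ℕ), 0 < nQ + ∑ i, nP i →
      ∀ (P : Fin m → Measure (Observation d)) (Q : Measure (Observation d))
        (ηP : Fin m → Covariate d → ℝ) (ηQ : Covariate d → ℝ),
        InPosteriorDriftClass α Cα β Cβ γ Cγ μlo μhi cμ rμ P Q ηP ηQ →
          ∀ x ∈ Q.fst.support, 0 < |ηQ x - 1 / 2| →
            (sampleLaw nQ nP P Q).real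
                {Z | multiKNNClassifier β γ Z.1 Z.2 x ≠ bayesClassifier ηQ x}
              ≤ A * (|ηQ x - 1 / 2| * effectiveSize d β γ nQ nP ^ (β / (2 * β + d)))
                  ^ (-(α + 2)) := by
  have hd0 : 0 < (d : ℝ) := by exact_mod_cast hd
  have hp : 0 < α + 2 := by linarith
  have hM : 0 < (m : ℝ) + 1 := by positivity
  -- The target is treated as a source with exponent and constant `1`. The proportion `1/(m+1)`
  -- comes from pigeonhole over `m + 1` samples.
  obtain ⟨cQ, UQ, hcQ, hUQ, hdomQ⟩ :=
    exists_weight_mul_count_ge d (γ := 1) (C := 1) hβ one_pos one_pos hM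
  choose cP UP hcP hUP hdomP using fun i =>
    exists_weight_mul_count_ge d (γ := γ i) (C := Cγ i) hβ (hγ i) (hCγ i) hM
  set V : ℝ := (volume : Measure (Covariate d)).real (Metric.ball 0 1) with hV
  have hV0 : 0 < V := ENNReal.toReal_pos (Metric.measure_ball_pos _ _ one_pos).ne'
    measure_ball_lt_top.ne
  -- The radius will be `c₀ * Δ ^ (1/β)`: the first entry keeps the oscillation of `ηQ` below `Δ/2`,
  -- the second keeps the radius below `rμ`, as `Δ ≤ 1`.
  set c₀ : ℝ := min ((1 / (2 * Cβ)) ^ (1 / β)) rμ with hc₀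
  have hc₀0 : 0 < c₀ := lt_min (by positivity) hrμ
  set c₁ : ℝ := μlo * cμ * V * c₀ ^ d with hc₁
  have hc₁0 : 0 < c₁ := by positivity
  obtain ⟨A₁, hA₁, hexp₁⟩ := exists_exp_neg_mul_rpow_le (c := c₁ / 2) (κ := d / β) (p := α + 2)
    (by positivity) (by positivity) hp
  obtain ⟨AQ, hAQ, hexpQ⟩ := exists_exp_neg_mul_rpow_le (c := 2 * cQ ^ 2 / (m + 1)) (κ := 2 * 1)
    (p := α + 2) (by positivity) (by positivity) hp
  choose AP hAP hexpP using fun i => exists_exp_neg_mul_rpow_le (c := 2 * cP i ^ 2 / (m + 1))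
    (κ := 2 * γ i) (p := α + 2) (by have := hcP i; positivity) (by have := hγ i; positivity) hp
  have hUPp : ∀ i, 0 ≤ UP i ^ (α + 2) := fun i => by have := hUP i; positivity
  have hsUP : 0 ≤ ∑ i, UP i ^ (α + 2) := Finset.sum_nonneg fun i _ => hUPp i
  have hsAP : 0 ≤ ∑ i, AP i := Finset.sum_nonneg fun i _ => (hAP i).le
  have hUQp : 0 < UQ ^ (α + 2) := by positivity
  have hball : 0 < (m + 1) * Real.exp 1 * A₁ := by positivity
  refine ⟨UQ ^ (α + 2) + ∑ i, UP i ^ (α + 2) + (m + 1) * Real.exp 1 * A₁ + AQ + ∑ i, AP i,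
    by positivity, fun nQ nP hn P Q ηP ηQ hPQ x hx hΔ => ?_⟩
  have := hPQ.isProb_source
  have := hPQ.isProb_target
  set N : ℝ := effectiveSize d β γ nQ nP with hN
  have hN0 : 0 < N := effectiveSize_pos hn
  set Δ : ℝ := |ηQ x - 1 / 2| with hΔdef
  have hΔ2 : Δ ≤ 1 / 2 := by
    have := hPQ.regression_target.mem_Icc x
    exact abs_le.2 ⟨by linarith [this.1], by linarith [this.2]⟩
  set u : ℝ := Δ * N ^ (β / (2 * β + d)) with hu
  have hu0 : 0 < u := by positivity
  have hup : 0 < u ^ (-(α + 2)) := by positivity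
  have htriv : ∀ U : ℝ, u ≤ U → 1 ≤ U ^ (α + 2) * u ^ (-(α + 2)) := fun U hU => by
    calc 1 = u ^ (α + 2) * u ^ (-(α + 2)) := by rw [← Real.rpow_add hu0]; simp
      _ ≤ _ := by gcongr
  -- For `u` below any threshold, the trivial bound `1` is absorbed by the summands `U ^ (α + 2)` of
  -- the constant.
  rcases lt_or_ge u UQ with huQ | huQ
  · refine measureReal_le_one.trans ((htriv UQ huQ.le).trans ?_)
    exact mul_le_mul_of_nonneg_right (by linarith) hup.le
  by_cases huP : ∃ i, u < UP i
  · obtain ⟨i, hi⟩ := huP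
    refine measureReal_le_one.trans ((htriv (UP i) hi.le).trans ?_)
    have := Finset.single_le_sum (fun i _ => hUPp i) (Finset.mem_univ i)
    exact mul_le_mul_of_nonneg_right (by linarith) hup.le
  push Not at huP
  set r : ℝ := c₀ * Δ ^ (1 / β) with hr
  have hr0 : 0 < r := by positivity
  have hrle : r ≤ rμ := by
    have h1 : Δ ^ (1 / β) ≤ 1 := Real.rpow_le_one hΔ.le (by linarith) (by positivity)
    have h2 : c₀ ≤ rμ := min_le_right _ _
    nlinarith
  have hrβ : Cβ * r ^ β ≤ |ηQ x - 1 / 2| / 2 := by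
    have h1 : r ^ β = c₀ ^ β * Δ := by
      rw [hr, Real.mul_rpow hc₀0.le (by positivity), ← Real.rpow_mul hΔ.le,
        one_div_mul_cancel hβ.ne', Real.rpow_one]
    have h2 : c₀ ^ β ≤ 1 / (2 * Cβ) := by
      calc c₀ ^ β ≤ ((1 / (2 * Cβ)) ^ (1 / β)) ^ β := by
            gcongr
            exact min_le_left _ _
        _ = _ := by
            rw [← Real.rpow_mul (by positivity), one_div_mul_cancel hβ.ne', Real.rpow_one]
    rw [h1]
    calc Cβ * (c₀ ^ β * Δ) ≤ Cβ * (1 / (2 * Cβ) * Δ) := by gcongr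
      _ = Δ / 2 := by field_simp
  have hrd : μlo * cμ * V * r ^ d = c₁ * Δ ^ (d / β) := by
    rw [hr, mul_pow, ← Real.rpow_natCast (Δ ^ (1 / β)), ← Real.rpow_mul hΔ.le, hc₁]
    ring_nf
  set sgn : ℝ := if ηQ x ≤ 1 / 2 then -1 else 1 with hsgn
  have hsgn' : sgn = -1 ∨ sgn = 1 := by
    rw [hsgn]
    split_ifs <;> simp
  have hηQ : ∀ y ∈ Q.fst.support, dist y x ≤ r → Δ / 2 ≤ sgn * (ηQ y - 1 / 2) := fun y hy hyx =>
    hPQ.smooth.half_margin_le hβ hCβ hx hy hyx hrβ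
  have hηP : ∀ i, ∀ y ∈ (P i).fst.support, dist y x ≤ r →
      Cγ i * (Δ / 2) ^ γ i ≤ sgn * (ηP i y - 1 / 2) := by
    intro i y hy hyx
    have hyQ := hηQ y ((hPQ.density i).support_eq ▸ hy) hyx
    obtain ⟨h1, h2⟩ := hPQ.signal i y (Or.inl hy)
    refine le_mul_of_signal hsgn' (lt_of_lt_of_le (by positivity) hyQ) h1 (le_trans ?_ h2)
    have h3 : Δ / 2 ≤ |ηQ y - 1 / 2| := by
      rcases hsgn' with h | h <;> rw [h] at hyQ
      · linarith [neg_abs_le (ηQ y - 1 / 2)]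
      · linarith [le_abs_self (ηQ y - 1 / 2)]
    have := hCγ i
    have := hγ i
    gcongr
  -- Regularity of the support, even of the target, is part of a source's density condition; `m ≥ 1`
  -- supplies an index.
  have hreg := fun i => (hPQ.density i).regular r hr0 hrle x hx
  have hmass : ∀ ν : Measure (Covariate d), IsFiniteMeasure ν → HasDensityBetween μlo μhi ν →
      ν.support = Q.fst.support → c₁ * Δ ^ (d / β) ≤ ν.real (Metric.closedBall x r) :=
    fun ν _ hν hνQ => by
      rw [← hrd]
      exact hν.le_real_closedBall hμlo.le hcμ.le hr0.le (by rw [hνQ]; exact hreg ⟨0, hm⟩)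
  have hcount : ∀ (n : ℕ) (ν : Measure (Covariate d)),
      c₁ * Δ ^ (d / β) ≤ ν.real (Metric.closedBall x r) →
      (⌊(n : ℝ) * N ^ (-((d : ℝ) / (2 * β + d)))⌋₊ : ℝ) * (c₁ * u ^ (d / β))
        ≤ n * ν.real (Metric.closedBall x r) := fun n ν hν => by
    have h1 : u ^ (d / β) = Δ ^ (d / β) * N ^ ((d : ℝ) / (2 * β + d)) := by
      rw [hu, Real.mul_rpow hΔ.le (by positivity), ← Real.rpow_mul hN0.le]
      congr 2
      field_simp
    calc _ = (⌊(n : ℝ) * N ^ (-((d : ℝ) / (2 * β + d)))⌋₊ : ℝ) * N ^ ((d : ℝ) / (2 * β + d))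
          * (c₁ * Δ ^ (d / β)) := by rw [h1]; ring
      _ ≤ _ := mul_le_mul (floor_count_mul_le hN0 _) hν (by positivity) (by positivity)
  have hNsum : N = (nQ : ℝ) + ∑ i, (nP i : ℝ) ^ ((2 * β + d) / (2 * γ i * β + d)) := rfl
  have hterm : ∀ i, 0 ≤ (nP i : ℝ) ^ ((2 * β + d) / (2 * γ i * β + d)) := fun i => by positivity
  have hQone : (nQ : ℝ) ^ ((2 * β + d) / (2 * 1 * β + d)) = nQ := by
    rw [mul_one, div_self (by positivity), Real.rpow_one]
  have hnQ : (nQ : ℝ) ^ ((2 * β + d) / (2 * 1 * β + d)) ≤ N := by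
    rw [hQone, hNsum]
    linarith [Finset.sum_nonneg fun i (_ : i ∈ Finset.univ) => hterm i]
  have hnP : ∀ i, (nP i : ℝ) ^ ((2 * β + d) / (2 * γ i * β + d)) ≤ N := fun i => by
    have h1 := Finset.single_le_sum (fun i _ => hterm i) (Finset.mem_univ i)
    have h2 : (0 : ℝ) ≤ nQ := by positivity
    rw [hNsum]
    linarith
  set kQ : ℕ := ⌊(nQ : ℝ) * N ^ (-((d : ℝ) / (2 * β + d)))⌋₊ with hkQ
  set kP : Fin m → ℕ := fun i => ⌊(nP i : ℝ) * N ^ (-((d : ℝ) / (2 * β + d)))⌋₊ with hkP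
  set wQ : ℝ := N ^ (-(β / (2 * β + d))) with hwQ
  set wP : Fin m → ℝ := fun i => N ^ (-(γ i * β / (2 * β + d))) with hwP
  have hwQ1 : N ^ (-(1 * β / (2 * β + d))) = wQ := by rw [one_mul]
  have hwP0 : ∀ i, 0 < wP i := fun i => by positivity
  have hbound : ∀ c g : ℝ, 0 < c →
      c * u ^ g ≤ wQ * kQ * (Δ / 2) + ∑ i, wP i * kP i * (Cγ i * (Δ / 2) ^ γ i) →
      (sampleLaw nQ nP P Q).real {Z | multiKNNClassifier β γ Z.1 Z.2 x ≠ bayesClassifier ηQ x}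
        ≤ (m + 1) * Real.exp 1 * A₁ * u ^ (-(α + 2))
          + Real.exp (-(2 * c ^ 2 / (m + 1) * u ^ (2 * g))) := by
    intro c g hc hsignal
    -- Minimiser of `-t * c * u ^ g + t ^ 2 * (m + 1) / 8`.
    set t : ℝ := 4 * c * u ^ g / (m + 1) with ht
    have ht0 : 0 ≤ t := by positivity
    have h := sampleLaw_wrong_sign_le (nP := nP) (v := c₁ * u ^ (d / β)) hPQ.regression_source
      hPQ.regression_target x kQ kP ht0
      (by rcases hsgn' with h | h <;> rw [h] <;> norm_num : sgn ^ 2 = 1)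
      (by positivity : 0 ≤ wQ) (fun i => (hwP0 i).le)
      (hcount nQ Q.fst (hmass _ inferInstance (hPQ.density ⟨0, hm⟩).density_target rfl))
      (fun i => hcount (nP i) (P i).fst (hmass _ inferInstance (hPQ.density i).density_source
        (hPQ.density i).support_eq)) hηQ hηP
      (by rw [← hwQ1]; exact weight_sq_mul_count_le hβ one_pos hN0 hnQ)
      (fun i => weight_sq_mul_count_le hβ (hγ i) hN0 (hnP i))
    refine (ENNReal.toReal_le_of_le_ofReal (by positivity) ((measure_mono fun Z hZ => ?_).trans
      h)).trans (add_le_add ?_ (Real.exp_le_exp.2 ?_))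
    · exact wrong_sign_of_multiKNNClassifier_ne hN.symm hN0 hZ
    · have := hexp₁ u hu0
      have h2 : Real.exp (1 - c₁ * u ^ (d / β) / 2)
          = Real.exp 1 * Real.exp (-(c₁ / 2 * u ^ (d / β))) := by
        rw [← Real.exp_add]
        ring_nf
      rw [h2]
      calc _ = (m + 1) * Real.exp 1 * Real.exp (-(c₁ / 2 * u ^ (d / β))) := by ring
        _ ≤ (m + 1) * Real.exp 1 * (A₁ * u ^ (-(α + 2))) := by gcongr
        _ = _ := by ring
    · have h3 := mul_le_mul_of_nonneg_left hsignal ht0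
      have h4 : u ^ (2 * g) = u ^ g * u ^ g := by rw [← Real.rpow_add hu0]; ring_nf
      have h5 : t ^ 2 * (m + 1) / 8 - t * (c * u ^ g) = -(2 * c ^ 2 / (m + 1) * u ^ (2 * g)) := by
        rw [h4, ht]
        field_simp
        ring
      linarith
  have hsigP : ∀ i, 0 ≤ wP i * kP i * (Cγ i * (Δ / 2) ^ γ i) := fun i => by
    have := hCγ i
    have := hwP0 i
    positivity
  have hsigQ : 0 ≤ wQ * kQ * (Δ / 2) := by positivity
  by_cases hQdom : N ≤ (m + 1) * (nQ : ℝ) ^ ((2 * β + d) / (2 * 1 * β + d))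
  · have h1 := hdomQ nQ N Δ hN0 hΔ hΔ2 hQdom huQ
    rw [hwQ1, one_mul, Real.rpow_one, Real.rpow_one] at h1
    have h2 := hbound cQ 1 hcQ (by
      rw [Real.rpow_one]
      linarith [Finset.sum_nonneg fun i (_ : i ∈ Finset.univ) => hsigP i])
    have h3 := hexpQ u hu0
    refine h2.trans ?_
    calc _ ≤ ((m + 1) * Real.exp 1 * A₁ + AQ) * u ^ (-(α + 2)) := by linarith
      _ ≤ _ := mul_le_mul_of_nonneg_right (by linarith) hup.le
  -- If all `m + 1` summands of `N` were below `N / (m + 1)`, they could not add up to `N`.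
  · have hPdom : ∃ i, N ≤ (m + 1) * (nP i : ℝ) ^ ((2 * β + d) / (2 * γ i * β + d)) := by
      by_contra! hcon
      rw [not_le, hQone] at hQdom
      have h1 : ∑ i, (m + 1) * (nP i : ℝ) ^ ((2 * β + d) / (2 * γ i * β + d)) ≤ ∑ _i : Fin m, N :=
        Finset.sum_le_sum fun i _ => (hcon i).le
      rw [← Finset.mul_sum, Finset.sum_const, Finset.card_univ, Fintype.card_fin,
        nsmul_eq_mul] at h1
      have h2 : (m + 1) * N = (m + 1) * (nQ : ℝ)
          + (m + 1) * ∑ i, (nP i : ℝ) ^ ((2 * β + d) / (2 * γ i * β + d)) := by rw [hNsum]; ring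
      linarith
    obtain ⟨i, hi⟩ := hPdom
    have h1 := hdomP i (nP i) N Δ hN0 hΔ hΔ2 hi (huP i)
    have h2 := hbound (cP i) (γ i) (hcP i) (by
      have := Finset.single_le_sum (fun i _ => hsigP i) (Finset.mem_univ i)
      refine h1.trans ?_
      linarith)
    have h3 := hexpP i u hu0
    have h4 := Finset.single_le_sum (fun i _ => (hAP i).le) (Finset.mem_univ i)
    refine h2.trans ?_
    calc _ ≤ ((m + 1) * Real.exp 1 * A₁ + AP i) * u ^ (-(α + 2)) := by linarith
      _ ≤ _ := mul_le_mul_of_nonneg_right (by linarith) hup.le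

end

/-! ### Integration of the pointwise bound -/

theorem theorem4 (d m : ℕ) (hd : 1 ≤ d) (hm : 1 ≤ m)
    (α Cα β Cβ : ℝ) (hα : 0 ≤ α) (hCα : 0 < Cα) (hβ : 0 < β) (hβ1 : β ≤ 1) (hCβ : 0 < Cβ)
    (γ Cγ : Fin m → ℝ) (hγ : ∀ i, 0 < γ i) (hCγ : ∀ i, 0 < Cγ i)
    (μlo μhi cμ rμ : ℝ) (hμlo : 0 < μlo) (hμ : μlo < μhi) (hcμ : 0 < cμ) (hrμ : 0 < rμ) :
    ∃ C : ℝ, 0 < C ∧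
      ∀ (nQ : ℕ) (nP : Fin m → ℕ), 0 < nQ + ∑ i, nP i →
        ∀ (P : Fin m → Measure (Observation d)) (Q : Measure (Observation d))
          (ηP : Fin m → Covariate d → ℝ) (ηQ : Covariate d → ℝ),
          InPosteriorDriftClass α Cα β Cβ γ Cγ μlo μhi cμ rμ P Q ηP ηQ →
            Integrable (fun Z => excessRisk Q ηQ (multiKNNClassifier β γ Z.1 Z.2))
                (sampleLaw nQ nP P Q) ∧
              ∫ Z, excessRisk Q ηQ (multiKNNClassifier β γ Z.1 Z.2) ∂(sampleLaw nQ nP P Q)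
                ≤ C * effectiveSize d β γ nQ nP ^ (-(β * (1 + α) / (2 * β + d))) := by
  obtain ⟨A, hA, hAle⟩ := exists_error_probability_le d m hd hm α Cα β Cβ hα hβ hCβ γ Cγ hγ hCγ
    μlo μhi cμ rμ hμlo hcμ hrμ
  -- The outer `2` comes from `|2 * ηQ x - 1| = 2 * |ηQ x - 1/2|`, the rest from
  -- `integral_mul_le_of_margin`.
  refine ⟨2 * (2 * (A * 2 ^ (α + 2) + 1) * Cα), by positivity, fun nQ nP hn P Q ηP ηQ hPQ => ?_⟩
  have := hPQ.isProb_source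
  have := hPQ.isProb_target
  have hreg := hPQ.regression_target
  have hη := hreg.measurable
  have hm := measurable_multiKNNClassifier (d := d) (nQ := nQ) (nP := nP) β γ
  obtain ⟨hint, heq⟩ := hreg.integral_excessRisk (sampleLaw nQ nP P Q)
    (F := fun Z => multiKNNClassifier β γ Z.1 Z.2) hm
  refine ⟨hint, heq.trans_le ?_⟩
  set N := effectiveSize d β γ nQ nP
  have hN : 0 < N := effectiveSize_pos hn
  have hbad : MeasurableSet {p : Covariate d × ((Fin nQ → Observation d) ×
      ((i : Fin m) → Fin (nP i) → Observation d)) |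
      multiKNNClassifier β γ p.2.1 p.2.2 p.1 ≠ bayesClassifier ηQ p.1} :=
    (measurableSet_eq_fun (hm.comp measurable_swap)
      ((measurable_bayesClassifier hη).comp measurable_fst)).compl
  have h := integral_mul_le_of_margin Q.fst (D := fun x => |ηQ x - 1 / 2|)
    (π := fun x => (sampleLaw nQ nP P Q).real
      {Z | multiKNNClassifier β γ Z.1 Z.2 x ≠ bayesClassifier ηQ x})
    (hη.sub_const _).abs (fun x => abs_nonneg _)
    (measurable_measure_prodMk_left hbad).ennreal_toReal
    (fun x => measureReal_nonneg) (fun x => measureReal_le_one) hα hCα hA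
    (by positivity : 0 < N ^ (-(β / (2 * β + d)))) hPQ.margin (by
      filter_upwards [Measure.support_mem_ae (μ := Q.fst)] with x hx hΔ
      rw [Real.rpow_neg hN.le (β / _), div_inv_eq_mul]
      exact hAle nQ nP hn P Q ηP ηQ hPQ x hx hΔ)
  have habs : ∀ x, |2 * ηQ x - 1| = 2 * |ηQ x - 1 / 2| := fun x => by
    rw [← abs_two, ← abs_mul, abs_two]
    ring_nf
  simp_rw [habs, mul_assoc (2 : ℝ)]
  rw [integral_const_mul]
  have hpow : (N ^ (-(β / (2 * β + d)))) ^ (1 + α) = N ^ (-(β * (1 + α) / (2 * β + d))) := by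
    rw [← Real.rpow_mul hN.le]
    congr 1
    ring
  rw [hpow] at h
  linarith
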